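/- Let $k$ be a field of characteristic $p>0$. A variety over $k$ is an integral scheme that is separated and of finite type over $k$. Let $X$ be a variety over $k$ such that $k$ is algebraically closed in the function field $K(X)$. An elemental extension of $(k,X)$ is a pair $(k\subset l\subset k',\ \varphi:X'\to X)$ consisting of field extensions $k\subset l\subset k'$ and a morphism of schemes $\varphi$ such that: $k\subset l$ is purely inseparable with $l^p\subset k$, and $X\times_k l$ is an integral scheme; $X'$ is the normalisation of $X\times_k l$, and $\varphi$ is the induced morphism $X'\to X\times_k l\to X$; and $k'$ is the algebraic closure of $l$ in $K(X')$. In particular $X'$ is a scheme over $k'$. Let $(k\subset l\subset k',\ \varphi:X'\to X)$ be an elemental extension of $(k,X)$ and let $k\subset k_1$ be a (not necessarily algebraic) separable field extension, i.e. $F\otimes_k k_1$ is reduced for every field extension $k\subset F$. Set $l_1:=l\otimes_k k_1$, $k_1':=k'\otimes_k k_1$, $X_1:=X\times_k k_1$, $X_1':=X'\times_k k_1$, and let $\varphi_1:X_1'\to X_1$ be the morphism induced by $\varphi$. Then the following hold. 1. $X_1$ is a variety over $k_1$ such that $k_1$ is algebraically closed in $K(X_1)$. Furthermore, if $X$ is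 normal, then $X_1$ is normal. 2. $l_1$ and $k_1'$ are fields. The induced ring extensions $k_1\subset l_1\subset k_1'$ are purely inseparable field extensions such that $(k_1')^p\subset k_1$. 3. $[l_1:k_1]=[l:k]$, $[k_1':l_1]=[k':l]$ and $[k_1':k_1]=[k':k]$ (as cardinal numbers). 4. $(k_1\subset l_1\subset k_1',\ \varphi_1:X_1'\to X_1)$ is an elemental extension of $(k_1,X_1)$. -/

import Mathlib

open CategoryTheory CategoryTheory.Limits AlgebraicGeometry
open scoped TensorProduct

universe u

namespace ElementalExt

noncomputable section

/-! ### Field extensions -/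

/-- A (not necessarily algebraic) field extension `K / k` is separable if `F ⊗[k] K` is reduced
for every field extension `F / k`. -/
def IsSeparableExtension (k K : Type u) [Field k] [Field K] [Algebra k K] : Prop :=
  ∀ (F : Type u) [Field F] [Algebra k F], IsReduced (F ⊗[k] K)

/-- The extension of rings given by a ring homomorphism `i` is purely inseparable. -/
def IsPurelyInseparableHom {R S : Type u} [CommRing R] [CommRing S] (i : R →+* S) : Prop :=
  letI : Algebra R S := i.toAlgebra
  IsPurelyInseparable R S

/-- The degree `[S : R]`, as a cardinal, of the extension given by `i : R → S`. -/
def degree {R S : Type u} [CommRing R] [CommRing S] (i : R →+* S) : Cardinal.{u} :=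
  letI : Algebra R S := i.toAlgebra
  Module.rank R S

/-- The element `x` of `S` is algebraic over `R` via `i : R → S`. -/
def IsAlgebraicElem {R S : Type u} [CommRing R] [CommRing S] (i : R →+* S) (x : S) : Prop :=
  letI : Algebra R S := i.toAlgebra
  IsAlgebraic R x

/-! ### Schemes over a ring -/

/-- The morphism `Spec S ⟶ Spec R` induced by a ring homomorphism `R → S`. -/
abbrev specMap {R S : Type u} [CommRing R] [CommRing S] (i : R →+* S) :
    Spec (CommRingCat.of S) ⟶ Spec (CommRingCat.of R) :=
  Spec.map (CommRingCat.ofHom i)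

/-- The homomorphism `R → K(X)` given by a morphism `X ⟶ Spec R` with `X` integral. -/
def toFunctionField {R : Type u} [CommRing R] {X : Scheme.{u}} [IsIntegral X]
    (α : X ⟶ Spec (CommRingCat.of R)) : R →+* X.functionField :=
  ((Scheme.ΓSpecIso (CommRingCat.of R)).inv ≫ α.appTop ≫ X.presheaf.germ ⊤ (genericPoint X) trivial).hom

/-- A variety over a field `k`: an integral scheme, separated and of finite type over `k`. -/
structure IsVariety {k : Type u} [Field k] {X : Scheme.{u}}
    (α : X ⟶ Spec (CommRingCat.of k)) : Prop where
  isIntegral : IsIntegral X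
  isSeparated : IsSeparated α
  locallyOfFiniteType : LocallyOfFiniteType α
  quasiCompact : QuasiCompact α

/-- The scheme `X` over `k` is integral and `k` is algebraically closed in `K(X)`. -/
structure IsAlgClosedInFunctionField {k : Type u} [Field k] {X : Scheme.{u}}
    (α : X ⟶ Spec (CommRingCat.of k)) : Prop where
  [isIntegral : IsIntegral X]
  mem_range : ∀ x : X.functionField,
    IsAlgebraicElem (toFunctionField α) x → x ∈ (toFunctionField α).range

/-- A scheme is normal if all its local rings are integrally closed domains. -/
def IsNormal (X : Scheme.{u}) : Prop :=
  ∀ x : X, IsDomain (X.presheaf.stalk x) ∧ IsIntegrallyClosed (X.presheaf.stalk x)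

/-- The morphism `ν : Y ⟶ Z` is the normalisation of the integral scheme `Z`: the scheme `Y` is
integral and normal, and `ν` is integral and birational. -/
structure IsNormalization {Y Z : Scheme.{u}} (ν : Y ⟶ Z) : Prop where
  [isIntegral_source : IsIntegral Y]
  [isIntegral_target : IsIntegral Z]
  isNormal : IsNormal Y
  isIntegralHom : IsIntegralHom ν
  map_genericPoint : ν (genericPoint Y) = genericPoint Z
  isIso_stalkMap : IsIso (ν.stalkMap (genericPoint Y))

/-! ### Elemental extensions -/

/-- Let `α : X ⟶ Spec k` be a variety such that `k` is algebraically closed in `K(X)`, with `k` of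
characteristic `p > 0`. Then `(k ⊂ l ⊂ k', φ : X' ⟶ X)` is an elemental extension of `(k, X)`.
The inclusions of fields are `i` and `j`, and the inclusion of `k'` in `K(X')` is the one given by
the structure morphism `α' : X' ⟶ Spec k'`. -/
structure IsElementalExtension (p : ℕ) {k l k' : Type u} [Field k] [CommRing l] [CommRing k']
    (i : k →+* l) (j : l →+* k') {X X' : Scheme.{u}} (α : X ⟶ Spec (CommRingCat.of k))
    (α' : X' ⟶ Spec (CommRingCat.of k')) (φ : X' ⟶ X) : Prop where
  isField_left : IsField l
  isField_right : IsField k'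
  isPurelyInseparable : IsPurelyInseparableHom i
  pow_mem_range : ∀ x : l, x ^ p ∈ i.range
  isIntegral_baseChange : IsIntegral (pullback α (specMap i))
  /-- The square formed by `φ`, `α`, `α'` and `Spec k' ⟶ Spec k` commutes. -/
  comm : φ ≫ α = α' ≫ specMap (j.comp i)
  /-- The morphism `X' ⟶ X ×ₖ l` with components `φ` and `X' ⟶ Spec k' ⟶ Spec l` is the
  normalisation of `X ×ₖ l`. -/
  isNormalization : IsNormalization
    (pullback.lift φ (α' ≫ specMap j) (by simp [comm, specMap]) : X' ⟶ pullback α (specMap i))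
  /-- The field `k'` is the algebraic closure of `l` in `K(X')`. -/
  isAlgebraicElem_iff :
    haveI : IsIntegral X' := isNormalization.isIntegral_source
    ∀ x : X'.functionField,
      IsAlgebraicElem ((toFunctionField α').comp j) x ↔ x ∈ (toFunctionField α').range

/-! ### Base change along `k → k₁` -/

section BaseChange

variable {k : Type u} [Field k] (k₁ : Type u) [Field k₁] [Algebra k k₁]

/-- The scheme `X ×ₖ k₁`. -/
abbrev baseChange {X : Scheme.{u}} (α : X ⟶ Spec (CommRingCat.of k)) : Scheme.{u} :=
  pullback α (specMap (algebraMap k k₁))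

/-- The projection `X ×ₖ k₁ ⟶ Spec k₁`. -/
abbrev baseChangeStr {X : Scheme.{u}} (α : X ⟶ Spec (CommRingCat.of k)) :
    baseChange k₁ α ⟶ Spec (CommRingCat.of k₁) :=
  pullback.snd α (specMap (algebraMap k k₁))

/-- The morphism `X' ×ₖ k₁ ⟶ X ×ₖ k₁` induced by `φ : X' ⟶ X`. -/
abbrev baseChangeMap {X X' : Scheme.{u}} (α : X ⟶ Spec (CommRingCat.of k)) (φ : X' ⟶ X) :
    baseChange k₁ (φ ≫ α) ⟶ baseChange k₁ α :=
  pullback.map (φ ≫ α) (specMap (algebraMap k k₁)) α (specMap (algebraMap k k₁)) φ (𝟙 _) (𝟙 _)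
    (by simp) (by simp)

/-- The morphism `X' ×ₖ k₁ ⟶ Spec k' ×ₖ k₁ = Spec (k' ⊗ₖ k₁)` induced by `α' : X' ⟶ Spec k'`. -/
abbrev baseChangeTop {k' : Type u} [Field k'] [Algebra k k'] {X' : Scheme.{u}}
    (β : X' ⟶ Spec (CommRingCat.of k)) (α' : X' ⟶ Spec (CommRingCat.of k'))
    (h : β = α' ≫ specMap (algebraMap k k')) :
    baseChange k₁ β ⟶ Spec (CommRingCat.of (k' ⊗[k] k₁)) :=
  pullback.map β (specMap (algebraMap k k₁)) (specMap (algebraMap k k'))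
    (specMap (algebraMap k k₁)) α' (𝟙 _) (𝟙 _) (by simp [h]) (by simp) ≫
    (pullbackSpecIso k k' k₁).hom

/-- The homomorphism `k₁ → A ⊗ₖ k₁`. -/
abbrev inclRight (A : Type u) [CommRing A] [Algebra k A] : k₁ →+* A ⊗[k] k₁ :=
  (Algebra.TensorProduct.includeRight : k₁ →ₐ[k] A ⊗[k] k₁).toRingHom

/-- The homomorphism `l ⊗ₖ k₁ → k' ⊗ₖ k₁` induced by `l → k'`. -/
abbrev tensorMap (l k' : Type u) [CommRing l] [CommRing k'] [Algebra k l] [Algebra k k']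
    [Algebra l k'] [IsScalarTower k l k'] : l ⊗[k] k₁ →+* k' ⊗[k] k₁ :=
  (Algebra.TensorProduct.map (IsScalarTower.toAlgHom k l k') (AlgHom.id k k₁)).toRingHom

end BaseChange

end

end ElementalExt

open ElementalExt

/-! Everything rests on one fact of commutative algebra: for `K / k` separable, base change to `K`
keeps an integrally closed map of `k`-algebras integrally closed
(`PreservesIntClosed.of_isSeparableExtension`). Integral closure commutes with smooth base change
and with localisation. By MacLane's criterion a finitely generated separable extension is finite
separable over a rational function field, so these two cases cover it, and a general `K` is the
union of its finitely generated subfields. The same dévissage shows that `K ⊗ F` is an integrally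
closed domain whenever `k` is algebraically closed in the field `F`
(`isIntegrallyClosed_tensorProduct`).

For an integral `k`-scheme `X`, the sections of `X ×ₖ K` over an affine `U` are `K ⊗ Γ(X, U)`, which
embeds in `K ⊗ K(X)`, and the function field of `X ×ₖ K` is the fraction field of `K ⊗ K(X)`.
Integrality, normality and algebraic closedness of the base field therefore follow from the algebra.

For an elemental extension, `K(X')` is the fraction field of `l ⊗ K(X)`, so `p`-th powers of
elements of `k'` lie in `K(X)`; being algebraic over `k`, they lie in `k`. Hence `l ⊗ k₁` and `k' ⊗
k₁` are reduced with `p`-th powers in `k₁`, which makes them fields. Finally `X' ×ₖ k₁` is the base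
change of `X'` from `k'` to `k' ⊗ k₁`, which is separable over `k'`, while `k'` is algebraically
closed in `K(X')`. So the results of the previous paragraph apply again, now over `k'`. -/

namespace ElementalExt

/-! ### Integrally closed ring homomorphisms -/

/-- Every element of `B` that is integral over `R` via `f : R → B` comes from `R`. -/
def IntClosed {R B : Type*} [CommRing R] [CommRing B] (f : R →+* B) : Prop :=
  ∀ x : B, f.IsIntegralElem x → x ∈ f.range

/-- Base change along `k → S` preserves integrally closed homomorphisms of `k`-algebras. -/
def PreservesIntClosed (k S : Type u) [CommRing k] [CommRing S] [Algebra k S] : Prop :=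
  ∀ (R B : Type u) [CommRing R] [CommRing B] [Algebra k R] [Algebra k B] (f : R →ₐ[k] B),
    IntClosed f.toRingHom →
      IntClosed (Algebra.TensorProduct.map (AlgHom.id k S) f).toRingHom

lemma IntClosed.comp {R S T : Type*} [CommRing R] [CommRing S] [CommRing T] {g : S →+* T}
    {f : R →+* S} (hg : IntClosed g) (hf : IntClosed f) (hinj : Function.Injective g) :
    IntClosed (g.comp f) := by
  intro x hx
  obtain ⟨y, rfl⟩ := hg x (hx.of_comp)
  obtain ⟨P, hP, hPy⟩ := hx
  obtain ⟨z, rfl⟩ := hf y ⟨P, hP, hinj (by rw [Polynomial.hom_eval₂, hPy, map_zero])⟩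
  exact ⟨z, rfl⟩

lemma IntClosed.of_ringEquiv {R S R' S' : Type*} [CommRing R] [CommRing S] [CommRing R']
    [CommRing S'] {f : R →+* S} {f' : R' →+* S'} (e : R ≃+* R') (e' : S ≃+* S')
    (h : ∀ x, f' (e x) = e' (f x)) (hf : IntClosed f) : IntClosed f' := by
  intro x hx
  have hx' : f.IsIntegralElem (e'.symm x) := by
    obtain ⟨P, hP, hPx⟩ := hx
    refine ⟨P.map e.symm.toRingHom, hP.map _, e'.injective ?_⟩
    have : (e'.toRingHom.comp f).comp e.symm.toRingHom = f' := by
      ext y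
      simpa using (h (e.symm y)).symm
    rw [Polynomial.eval₂_map]
    change e'.toRingHom _ = _
    rw [Polynomial.hom_eval₂, ← RingHom.comp_assoc, this]
    simpa using hPx
  obtain ⟨y, hy⟩ := hf _ hx'
  exact ⟨e y, by rw [h, hy, e'.apply_symm_apply]⟩

/-- Surjectivity says that the integral closure of `S` in `S ⊗ B` is spanned by tensors `s ⊗ b` with
`b` integral over `R`; such a `b` comes from `R` and can be moved to the left factor. -/
lemma IntClosed.of_toIntegralClosure {R S B : Type*} [CommRing R] [CommRing S] [CommRing B]
    [Algebra R S] [Algebra R B]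
    (h : Function.Surjective (TensorProduct.toIntegralClosure R S B))
    (hf : IntClosed (algebraMap R B)) : IntClosed (algebraMap S (S ⊗[R] B)) := by
  intro x hx
  obtain ⟨w, hw⟩ := h ⟨x, hx⟩
  have hw : (TensorProduct.toIntegralClosure R S B w : S ⊗[R] B) = x := congrArg Subtype.val hw
  rw [← hw]
  induction w generalizing x with
  | zero => simp
  | add a b ha hb =>
    simp only [map_add, Subalgebra.coe_add]
    exact add_mem (ha _ (TensorProduct.toIntegralClosure R S B a).2 rfl rfl)
      (hb _ (TensorProduct.toIntegralClosure R S B b).2 rfl rfl)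
  | tmul s b =>
    obtain ⟨r, hr⟩ := hf b.1 b.2
    refine ⟨r • s, ?_⟩
    simp [TensorProduct.toIntegralClosure, ← hr, Algebra.algebraMap_eq_smul_one,
      Algebra.TensorProduct.one_def, TensorProduct.smul_tmul']

lemma PreservesIntClosed.of_toIntegralClosure (k S : Type u) [CommRing k] [CommRing S] [Algebra k S]
    (h : ∀ (R B : Type u) [CommRing R] [CommRing B] [Algebra k R] [Algebra R B],
      Function.Surjective (TensorProduct.toIntegralClosure R (R ⊗[k] S) B)) :
    PreservesIntClosed k S := by
  intro R B _ _ _ _ f hf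
  let := f.toRingHom.toAlgebra
  have : IsScalarTower k R B := .of_algebraMap_eq' f.comp_algebraMap.symm
  have := IntClosed.of_toIntegralClosure (h R B) hf
  -- The hypothesis concerns base change from `R` to `R ⊗ S`; this identification turns it into base
  -- change from `k` to `S`.
  let e' : (R ⊗[k] S) ⊗[R] B ≃+* S ⊗[k] B :=
    ((Algebra.TensorProduct.comm R (R ⊗[k] S) B).toRingEquiv.trans
      (Algebra.TensorProduct.cancelBaseChange k R R B S).toRingEquiv).trans
      (Algebra.TensorProduct.comm k B S).toRingEquiv
  refine this.of_ringEquiv (Algebra.TensorProduct.comm k R S).toRingEquiv e' ?_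
  intro x
  induction x with
  | zero => simp
  | add a b ha hb => simp only [map_add, ha, hb]
  | tmul r s =>
    simp [e', Algebra.TensorProduct.algebraMap_apply, Algebra.smul_def]
    rfl

lemma PreservesIntClosed.of_smooth (k S : Type u) [CommRing k] [CommRing S] [Algebra k S]
    [Algebra.Smooth k S] : PreservesIntClosed k S :=
  .of_toIntegralClosure k S fun _ _ ↦ TensorProduct.toIntegralClosure_bijective_of_smooth.surjective

lemma PreservesIntClosed.of_isLocalization (k S : Type u) [CommRing k] [CommRing S] [Algebra k S]
    (M : Submonoid k) [IsLocalization M S] : PreservesIntClosed k S :=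
  .of_toIntegralClosure k S fun R _ _ _ _ _ ↦
    (TensorProduct.toIntegralClosure_bijective_of_isLocalization
      (Algebra.algebraMapSubmonoid R M)).surjective

lemma PreservesIntClosed.trans {k S T : Type u} [CommRing k] [CommRing S] [CommRing T]
    [Algebra k S] [Algebra S T] [Algebra k T] [IsScalarTower k S T]
    (h₁ : PreservesIntClosed k S) (h₂ : PreservesIntClosed S T) : PreservesIntClosed k T := by
  intro R B _ _ _ _ f hf
  have h := h₂ (S ⊗[k] R) (S ⊗[k] B) (Algebra.TensorProduct.map (AlgHom.id S S) f) (h₁ R B f hf)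
  refine h.of_ringEquiv (Algebra.TensorProduct.cancelBaseChange k S S T R).toRingEquiv
    (Algebra.TensorProduct.cancelBaseChange k S S T B).toRingEquiv ?_
  intro x
  induction x with
  | zero => simp
  | add a b ha hb => simp only [map_add, ha, hb]
  | tmul t y =>
    induction y with
    | zero => simp
    | add a b ha hb => simp only [TensorProduct.tmul_add, map_add, ha, hb]
    | tmul s r => simp


/-! ### Separable field extensions -/

lemma IsSeparableExtension.of_injective {k E K : Type u} [Field k] [Field E] [Field K]
    [Algebra k E] [Algebra k K] (h : IsSeparableExtension k K) (f : E →ₐ[k] K) :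
    IsSeparableExtension k E := fun F _ _ ↦
  have := h F
  isReduced_of_injective (Algebra.TensorProduct.map (AlgHom.id k F) f)
    (Module.Flat.lTensor_preserves_injective_linearMap f.toLinearMap f.injective)

/-- One half of MacLane's criterion. Given `∑ gᵢ eᵢ ^ p = 0`, take `p`-th roots `dᵢ` of the `gᵢ` in
an algebraic closure: the `p`-th power of `∑ dᵢ ⊗ eᵢ` vanishes, so reducedness kills the sum, and
linear independence of the `eᵢ` gives `dᵢ = 0`. -/
lemma IsSeparableExtension.linearIndepOn_pow {k E : Type u} [Field k] [Field E] [Algebra k E]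
    (h : IsSeparableExtension k E) (p : ℕ) [Fact p.Prime] [CharP k p] (s : Finset E)
    (hs : LinearIndepOn k id (s : Set E)) : LinearIndepOn k (· ^ p) (s : Set E) := by
  classical
  have := h (AlgebraicClosure k)
  have : CharP (AlgebraicClosure k) p := charP_of_injective_algebraMap (algebraMap k _).injective p
  have : CharP (AlgebraicClosure k ⊗[k] E) p :=
    charP_of_injective_algebraMap (algebraMap (AlgebraicClosure k) _).injective p
  -- Linear independence of the `eᵢ` over `k` persists after the flat base change to the algebraic
  -- closure.
  have hs' : ∀ d : ↥(s : Set E) → AlgebraicClosure k, ∑ i : ↥(s : Set E), d i ⊗ₜ[k] (i : E) = 0 →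
      ∀ i, d i = 0 := by
    intro d hd i
    have hinj : Function.Injective (Fintype.linearCombination k ((↑) : ↥(s : Set E) → E)) :=
      LinearIndependent.fintypeLinearCombination_injective hs
    have := Module.Flat.lTensor_preserves_injective_linearMap (M := AlgebraicClosure k) _ hinj
    have h0 : ∑ i : ↥(s : Set E), d i ⊗ₜ[k] (Pi.single i 1 : ↥(s : Set E) → k) = 0 :=
      this (by simpa [Fintype.linearCombination_apply_single] using hd)
    simpa [Pi.single_apply] using
      congr(TensorProduct.piScalarRight k k (AlgebraicClosure k) ↥(s : Set E) $h0 i)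
  rw [LinearIndepOn, Fintype.linearIndependent_iff]
  intro g hg i
  have hex : ∀ i : ↥(s : Set E), ∃ d : AlgebraicClosure k, d ^ p = algebraMap k _ (g i) := fun i ↦
    IsAlgClosed.exists_pow_nat_eq _ (Fact.out : p.Prime).pos
  choose d hd using hex
  have key : (∑ i : ↥(s : Set E), d i ⊗ₜ[k] (i : E)) ^ p = (0 : AlgebraicClosure k ⊗[k] E) := by
    rw [sum_pow_char]
    have : ∀ i : ↥(s : Set E), (d i ⊗ₜ[k] (i : E) : AlgebraicClosure k ⊗[k] E) ^ p =
        1 ⊗ₜ (g i • (i : E) ^ p) := fun i ↦ by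
      rw [Algebra.TensorProduct.tmul_pow, hd, Algebra.algebraMap_eq_smul_one,
        TensorProduct.smul_tmul]
    simp only [this, ← TensorProduct.tmul_sum, hg, TensorProduct.tmul_zero]
  have h0 := eq_zero_of_pow_eq_zero key
  have h1 := hd i
  rw [hs' d h0 i, zero_pow (Fact.out : p.Prime).ne_zero, eq_comm] at h1
  simpa using h1

/-! ### Finitely generated separable extensions -/

/-- A finitely generated separable extension is a finite separable extension of a rational
function field. -/
lemma IsSeparableExtension.exists_adjoin {k E : Type u} [Field k] [Field E] [Algebra k E]
    (h : IsSeparableExtension k E) (p : ℕ) [Fact p.Prime] [CharP k p] [Algebra.EssFiniteType k E] :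
    ∃ s : Finset E, AlgebraicIndependent k ((↑) : s → E) ∧
      Algebra.IsSeparable (IntermediateField.adjoin k (s : Set E)) E ∧
      Module.Finite (IntermediateField.adjoin k (s : Set E)) E := by
  have : ExpChar k p := .prime Fact.out
  obtain ⟨s, hs, hsep⟩ :=
    exists_isTranscendenceBasis_and_isSeparable_of_linearIndepOn_pow_of_essFiniteType
      (k := k) (K := E) p Fact.out (h.linearIndepOn_pow p)
  refine ⟨s, hs.1, hsep, ?_⟩
  -- Essentially of finite type and algebraic over the rational function field, hence finite.
  have : Algebra.EssFiniteType (IntermediateField.adjoin k (s : Set E)) E := .of_comp k _ _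
  exact Algebra.finite_of_essFiniteType_of_isAlgebraic

lemma isFractionRing_adjoin {k E : Type u} [Field k] [Field E] [Algebra k E] (s : Finset E)
    (hs : AlgebraicIndependent k ((↑) : s → E)) :
    ∃ _ : Algebra (MvPolynomial s k) (IntermediateField.adjoin k (s : Set E)),
      IsScalarTower k (MvPolynomial s k) (IntermediateField.adjoin k (s : Set E)) ∧
      IsFractionRing (MvPolynomial s k) (IntermediateField.adjoin k (s : Set E)) := by
  have hr : Set.range ((↑) : s → E) = s := by simp
  let e : FractionRing (MvPolynomial s k) ≃ₐ[k] IntermediateField.adjoin k (s : Set E) :=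
    hs.aevalEquivField.trans (IntermediateField.equivOfEq (by rw [hr]))
  let := (e.toRingHom.comp (algebraMap (MvPolynomial s k) _)).toAlgebra
  refine ⟨this, ?_, ?_⟩
  · refine .of_algebraMap_eq fun x ↦ ?_
    change _ = e (algebraMap (MvPolynomial s k) (FractionRing (MvPolynomial s k))
      (algebraMap k (MvPolynomial s k) x))
    rw [← IsScalarTower.algebraMap_apply, e.commutes]
  · exact IsLocalization.isLocalization_of_algEquiv (nonZeroDivisors (MvPolynomial s k))
      (AlgEquiv.ofRingEquiv (f := e.toRingEquiv) fun _ ↦ rfl)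

lemma PreservesIntClosed.adjoin {k E : Type u} [Field k] [Field E] [Algebra k E] (s : Finset E)
    (hs : AlgebraicIndependent k ((↑) : s → E)) :
    PreservesIntClosed k (IntermediateField.adjoin k (s : Set E)) := by
  obtain ⟨_, _, _⟩ := isFractionRing_adjoin s hs
  have : Algebra.Smooth k (MvPolynomial s k) := ⟨inferInstance, inferInstance⟩
  exact (PreservesIntClosed.of_smooth k (MvPolynomial s k)).trans
    (.of_isLocalization _ _ (nonZeroDivisors (MvPolynomial s k)))

lemma smooth_of_isSeparable (K E : Type u) [Field K] [Field E] [Algebra K E]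
    [Algebra.IsSeparable K E] [Module.Finite K E] : Algebra.Smooth K E := by
  have : Algebra.FormallyEtale K E := Algebra.FormallyEtale.of_isSeparable K E
  have : Algebra.FinitePresentation K E := Algebra.FinitePresentation.of_finiteType.mp inferInstance
  exact {}

lemma PreservesIntClosed.of_essFiniteType {k E : Type u} [Field k] [Field E] [Algebra k E]
    (h : IsSeparableExtension k E) (p : ℕ) [Fact p.Prime] [CharP k p] [Algebra.EssFiniteType k E] :
    PreservesIntClosed k E := by
  obtain ⟨s, hs, _, _⟩ := h.exists_adjoin p
  have := smooth_of_isSeparable (IntermediateField.adjoin k (s : Set E)) E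
  exact (PreservesIntClosed.adjoin s hs).trans (.of_smooth _ _)

/-! ### Descent to finitely generated subextensions -/

section Descent

variable {k K : Type u} [Field k] [Field K] [Algebra k K] (R : Type u) [CommRing R] [Algebra k R]

/-- The inclusion `E ⊗ R → K ⊗ R` for an intermediate field `E` of `K / k`. -/
noncomputable abbrev inclTensor (E : IntermediateField k K) : E ⊗[k] R →ₐ[k] K ⊗[k] R :=
  Algebra.TensorProduct.map E.val (AlgHom.id k R)

lemma inclTensor_injective (E : IntermediateField k K) : Function.Injective (inclTensor R E) :=
  Module.Flat.rTensor_preserves_injective_linearMap E.val.toLinearMap E.val.injective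

lemma range_inclTensor_mono {E E' : IntermediateField k K} (h : E ≤ E') :
    (inclTensor R E).range ≤ (inclTensor R E').range := by
  rintro _ ⟨x, rfl⟩
  refine ⟨Algebra.TensorProduct.map (IntermediateField.inclusion h) (AlgHom.id k R) x, ?_⟩
  induction x with
  | zero => simp
  | add a b ha hb => simp only [map_add, ha, hb]
  | tmul a b => simp

variable {R} in
lemma exists_fg_mem_range (x : K ⊗[k] R) :
    ∃ E : IntermediateField k K, E.FG ∧ x ∈ (inclTensor R E).range := by
  induction x with
  | zero => exact ⟨⊥, IntermediateField.fg_bot, zero_mem _⟩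
  | add a b ha hb =>
    obtain ⟨E, hE, ha⟩ := ha
    obtain ⟨E', hE', hb⟩ := hb
    exact ⟨E ⊔ E', IntermediateField.fg_sup hE hE', add_mem (range_inclTensor_mono R le_sup_left ha)
      (range_inclTensor_mono R le_sup_right hb)⟩
  | tmul a b =>
    refine ⟨IntermediateField.adjoin k {a}, ⟨{a}, by simp⟩,
      (⟨a, IntermediateField.mem_adjoin_simple_self k a⟩ : IntermediateField.adjoin k {a}) ⊗ₜ b, ?_⟩
    simp

variable {R} in
-- With `exists_fg_mem_range`, this lets an element and its integral equation be descended to a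
-- common finitely generated subfield.
lemma exists_fg_map_eq (P : Polynomial (K ⊗[k] R)) :
    ∃ E : IntermediateField k K, E.FG ∧ P ∈ Polynomial.lifts (inclTensor R E).toRingHom := by
  induction P using Polynomial.induction_on' with
  | add P Q hP hQ =>
    obtain ⟨E, hE, hP⟩ := hP
    obtain ⟨E', hE', hQ⟩ := hQ
    refine ⟨E ⊔ E', IntermediateField.fg_sup hE hE', add_mem ?_ ?_⟩ <;>
    rw [Polynomial.lifts_iff_coeff_lifts] at hP hQ ⊢
    · exact fun n ↦ range_inclTensor_mono R le_sup_left (hP n)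
    · exact fun n ↦ range_inclTensor_mono R le_sup_right (hQ n)
  | monomial n a =>
    obtain ⟨E, hE, ha⟩ := exists_fg_mem_range a
    obtain ⟨b, rfl⟩ := ha
    exact ⟨E, hE, Polynomial.monomial_mem_lifts n ⟨b, rfl⟩⟩

end Descent

/-- An integral element and its monic equation already live over a finitely generated `E ⊆ K`. Since
`E ⊗ B → K ⊗ B` is injective, the equation holds there, and the finitely generated case applies. -/
theorem PreservesIntClosed.of_isSeparableExtension {k K : Type u} [Field k] [Field K] [Algebra k K]
    (h : IsSeparableExtension k K) (p : ℕ) [Fact p.Prime] [CharP k p] :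
    PreservesIntClosed k K := by
  rintro R B _ _ _ _ f hf x ⟨P, hP, hPx⟩
  obtain ⟨E₁, hE₁, hx⟩ := exists_fg_mem_range x
  obtain ⟨E₂, hE₂, hP'⟩ := exists_fg_map_eq P
  have hE := IntermediateField.fg_sup hE₁ hE₂
  generalize hEdef : E₁ ⊔ E₂ = E at hE
  obtain ⟨y, rfl⟩ := range_inclTensor_mono B (hEdef ▸ le_sup_left) hx
  have hP'' : P ∈ Polynomial.lifts (inclTensor R E).toRingHom := by
    rw [Polynomial.lifts_iff_coeff_lifts] at hP' ⊢
    exact fun n ↦ range_inclTensor_mono R (hEdef ▸ le_sup_right) (hP' n)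
  obtain ⟨Q, rfl, -, hQ⟩ := Polynomial.lifts_and_natDegree_eq_and_monic hP'' hP
  have : Algebra.EssFiniteType k E := by
    exact IntermediateField.essFiniteType_iff.mpr hE
  have hc : (Algebra.TensorProduct.map (AlgHom.id k K) f).toRingHom.comp
      (inclTensor R E).toRingHom = (inclTensor B E).toRingHom.comp
        (Algebra.TensorProduct.map (AlgHom.id k E) f).toRingHom := by
    ext x <;> simp
  obtain ⟨z, rfl⟩ := PreservesIntClosed.of_essFiniteType (h.of_injective E.val) p R B f hf y
    ⟨Q, hQ, inclTensor_injective B E (by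
      rw [map_zero, ← hPx, Polynomial.eval₂_map, hc, ← Polynomial.hom_eval₂]; rfl)⟩
  exact ⟨inclTensor R E z, congr($hc z)⟩


/-! ### Integrally closed domains -/

/-- The vanishing says that `a / b` is a root of `P`. With the converse
`isIntegrallyClosed_of_forall_dvd`, this expresses integral closedness without fractions, in a form
that passes to increasing unions of rings. -/
lemma dvd_of_eval_scaleRoots_eq_zero {R : Type*} [CommRing R] [IsDomain R] [IsIntegrallyClosed R]
    {a b : R} (hb : b ≠ 0) {P : Polynomial R} (hP : P.Monic) (h : (P.scaleRoots b).eval a = 0) :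
    b ∣ a := by
  let K := FractionRing R
  have hb' : algebraMap R K b ≠ 0 := by simpa using hb
  have : IsIntegral R (algebraMap R K a / algebraMap R K b) := by
    refine ⟨P, hP, ?_⟩
    have := Polynomial.scaleRoots_eval₂_mul (p := P) (algebraMap R K)
      (algebraMap R K a / algebraMap R K b) b
    rw [mul_div_cancel₀ _ hb', Polynomial.eval₂_at_apply, h, map_zero, eq_comm] at this
    exact (mul_eq_zero.mp this).resolve_left (pow_ne_zero _ hb')
  obtain ⟨c, hc⟩ := IsIntegrallyClosed.isIntegral_iff.mp this
  refine ⟨c, IsFractionRing.injective R K ?_⟩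
  rw [map_mul, hc, mul_div_cancel₀ _ hb']

lemma isIntegrallyClosed_of_forall_dvd {R : Type*} [CommRing R] [IsDomain R]
    (h : ∀ (a b : R), b ≠ 0 → ∀ P : Polynomial R, P.Monic →
      (P.scaleRoots b).eval a = 0 → b ∣ a) : IsIntegrallyClosed R := by
  let K := FractionRing R
  refine (isIntegrallyClosed_iff K).mpr fun {x} ⟨P, hP, hx⟩ ↦ ?_
  obtain ⟨a, b, hb, rfl⟩ := IsFractionRing.div_surjective (A := R) x
  have hb' : algebraMap R K b ≠ 0 := by simpa using nonZeroDivisors.ne_zero hb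
  have := Polynomial.scaleRoots_eval₂_mul (p := P) (algebraMap R K)
      (algebraMap R K a / algebraMap R K b) b
  rw [mul_div_cancel₀ _ hb', Polynomial.eval₂_at_apply, hx, mul_zero,
    map_eq_zero_iff _ (IsFractionRing.injective R K)] at this
  obtain ⟨c, rfl⟩ := h a b (nonZeroDivisors.ne_zero hb) P hP this
  exact ⟨c, by rw [map_mul, mul_div_cancel_left₀ _ hb']⟩

/-- The quotient `f a / f b` exists in `L` because `L` is integrally closed; it is integral over
`R`, hence comes from `R`. -/
lemma IntClosed.isIntegrallyClosed {R L : Type*} [CommRing R] [IsDomain R] [CommRing L] [IsDomain L]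
    [IsIntegrallyClosed L] {f : R →+* L} (hf : IntClosed f) (hinj : Function.Injective f) :
    IsIntegrallyClosed R := by
  refine isIntegrallyClosed_of_forall_dvd fun a b hb P hP h ↦ ?_
  have hb' : f b ≠ 0 := (map_ne_zero_iff f hinj).mpr hb
  obtain ⟨c, hc⟩ : f b ∣ f a := by
    refine dvd_of_eval_scaleRoots_eq_zero hb' (hP.map f) ?_
    rw [← Polynomial.map_scaleRoots _ _ _ (by simp [hP.leadingCoeff]), Polynomial.eval_map_apply, h,
      map_zero]
  have hc' : c ∈ f.range := by
    refine hf c ⟨P, hP, ?_⟩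
    have := Polynomial.scaleRoots_eval₂_mul (p := P) f c b
    rw [← hc, Polynomial.eval₂_at_apply, h, map_zero, eq_comm] at this
    exact (mul_eq_zero.mp this).resolve_left (pow_ne_zero _ hb')
  obtain ⟨c, rfl⟩ := hc'
  exact ⟨c, hinj (by rw [hc, map_mul])⟩

/-! ### Tensor products of fields -/

/-- A reduced Artinian ring without nontrivial idempotents is a field. -/
lemma isField_of_isArtinianRing {A : Type*} [CommRing A] [Nontrivial A] [IsArtinianRing A]
    [IsReduced A] (h : ∀ e : A, IsIdempotentElem e → e = 0 ∨ e = 1) : IsField A := by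
  refine ⟨⟨0, 1, zero_ne_one⟩, mul_comm, fun {x} hx ↦ ?_⟩
  obtain ⟨n, y, hy⟩ := IsArtinian.exists_pow_succ_smul_dvd x (1 : A)
  simp only [smul_eq_mul, mul_one] at hy
  -- The stabilised chain gives `x ^ n = x ^ (n + 1) * y`, so this product is nilpotent. It follows
  -- that `x * y` is idempotent.
  have h0 : x * (1 - x * y) = 0 := by
    refine eq_zero_of_pow_eq_zero (n := n + 1) ?_
    have : x ^ n * (1 - x * y) = 0 := by
      rw [mul_sub, mul_one, ← mul_assoc, ← pow_succ, hy, sub_self]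
    rw [mul_pow, pow_succ, pow_succ' (1 - x * y)]
    linear_combination x * (1 - x * y) ^ n * this
  rcases h (x * y) (by unfold IsIdempotentElem; linear_combination (-y) * h0) with h | h
  · simp_all
  · exact ⟨y, h⟩

lemma PreservesIntClosed.includeLeft {k K F : Type u} [CommRing k] [CommRing K] [CommRing F]
    [Algebra k K] [Algebra k F] (hK : PreservesIntClosed k K) (hF : IntClosed (algebraMap k F)) :
    IntClosed (algebraMap K (K ⊗[k] F)) := by
  refine (hK k F (Algebra.ofId k F) hF).of_ringEquiv
    (Algebra.TensorProduct.rid k K K).toRingEquiv (RingEquiv.refl _) ?_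
  intro x
  induction x with
  | zero => simp
  | add a b ha hb => simp only [map_add, ha, hb]
  | tmul a b =>
    simp [Algebra.ofId_apply, Algebra.algebraMap_eq_smul_one, Algebra.TensorProduct.one_def,
      TensorProduct.smul_tmul']

/-- The ring is finite and étale over `L`, hence Artinian and reduced. An idempotent is a root of `X
^ 2 - X`, so it is integral over `E`, lies in `E`, and is `0` or `1`. -/
lemma isField_tensorProduct {K E L : Type u} [Field K] [Field E] [Field L] [Algebra K E]
    [Algebra K L] [Algebra.IsSeparable K E] [Module.Finite K E]
    (h : IntClosed (algebraMap K L)) : IsField (E ⊗[K] L) := by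
  have := smooth_of_isSeparable K E
  have hE : IntClosed (algebraMap E (E ⊗[K] L)) := (PreservesIntClosed.of_smooth K E).includeLeft h
  have : Algebra.FormallyEtale K E := Algebra.FormallyEtale.of_isSeparable K E
  have : IsReduced (L ⊗[K] E) := Algebra.FormallyUnramified.isReduced_of_field L _
  have : IsReduced (E ⊗[K] L) :=
    isReduced_of_injective (Algebra.TensorProduct.comm K E L) (AlgEquiv.injective _)
  have : IsArtinianRing (L ⊗[K] E) := isArtinian_of_tower L inferInstance
  have : IsArtinianRing (E ⊗[K] L) :=
    (Algebra.TensorProduct.comm K L E).toRingEquiv.surjective.isArtinianRing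
  refine isField_of_isArtinianRing fun e he ↦ ?_
  obtain ⟨y, rfl⟩ := hE e ⟨Polynomial.X ^ 2 - Polynomial.X, by monicity!, by
    simp [sq, he.eq]⟩
  have hy : IsIdempotentElem y := by
    refine (algebraMap E (E ⊗[K] L)).injective ?_
    rw [map_mul]; exact he
  rcases IsIdempotentElem.iff_eq_zero_or_one.mp hy with rfl | rfl <;>
    simp [Algebra.TensorProduct.one_def]

/-- The ring is a localisation of `k[s] ⊗ F`, that is, of the polynomial ring `F[s]`. -/
lemma isIntegrallyClosed_tensorProduct_adjoin {k E F : Type u} [Field k] [Field E] [Field F]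
    [Algebra k E] [Algebra k F] (s : Finset E) (hs : AlgebraicIndependent k ((↑) : s → E)) :
    IsDomain (IntermediateField.adjoin k (s : Set E) ⊗[k] F) ∧
      IsIntegrallyClosed (IntermediateField.adjoin k (s : Set E) ⊗[k] F) := by
  obtain ⟨_, _, _⟩ := isFractionRing_adjoin s hs
  let K := IntermediateField.adjoin k (s : Set E)
  let R := MvPolynomial s k
  let B := R ⊗[k] F
  let e : B ≃+* MvPolynomial s F :=
    ((Algebra.TensorProduct.comm k R F).toRingEquiv.trans
      (MvPolynomial.algebraTensorAlgEquiv k F).toRingEquiv)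
  have : IsDomain B := e.injective.isDomain e.toRingHom
  have : IsIntegrallyClosed B := .of_equiv e.symm
  let e' : B ⊗[R] K ≃+* K ⊗[k] F :=
    (Algebra.TensorProduct.comm R B K).toRingEquiv.trans
      (Algebra.TensorProduct.cancelBaseChange k R R K F).toRingEquiv
  have hinj : Function.Injective (algebraMap R B) :=
    Algebra.TensorProduct.includeLeft_injective (S := k) (algebraMap k F).injective
  have hle : Algebra.algebraMapSubmonoid B (nonZeroDivisors R) ≤ nonZeroDivisors B :=
    map_le_nonZeroDivisors_of_injective _ hinj le_rfl
  have : IsDomain (B ⊗[R] K) := IsLocalization.isDomain_of_le_nonZeroDivisors (B ⊗[R] K) hle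
  have : IsIntegrallyClosed (B ⊗[R] K) := isIntegrallyClosed_of_isLocalization _ _ hle
  exact ⟨MulEquiv.isDomain (B ⊗[R] K) e'.symm.toMulEquiv,
    IsIntegrallyClosed.of_equiv (R := B ⊗[R] K) (S := K ⊗[k] F) e'⟩

/-- Let `L` be the fraction field of `K ⊗ F`. Then `K` is algebraically closed in `L`, so `E ⊗ L` is
a field; it contains `E ⊗ F`, which is integrally closed in it because `K ⊗ F` is so in `L` and `E /
K` is smooth. -/
lemma isIntegrallyClosed_tensorProduct_of_tower {k K E F : Type u} [Field k] [Field K] [Field E]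
    [Field F] [Algebra k K] [Algebra K E] [Algebra k E] [IsScalarTower k K E] [Algebra k F]
    [Algebra.IsSeparable K E] [Module.Finite K E] [IsDomain (K ⊗[k] F)]
    [IsIntegrallyClosed (K ⊗[k] F)] (hK : PreservesIntClosed k K)
    (hF : IntClosed (algebraMap k F)) :
    IsDomain (E ⊗[k] F) ∧ IsIntegrallyClosed (E ⊗[k] F) := by
  have := smooth_of_isSeparable K E
  have hKF : IntClosed (algebraMap K (K ⊗[k] F)) := hK.includeLeft hF
  let L := FractionRing (K ⊗[k] F)
  have hL : IntClosed (algebraMap (K ⊗[k] F) L) := fun x hx ↦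
    IsIntegrallyClosed.isIntegral_iff.mp hx
  have hLinj : Function.Injective (algebraMap (K ⊗[k] F) L) := IsFractionRing.injective _ _
  have hKL : IntClosed (algebraMap K L) := by
    rw [IsScalarTower.algebraMap_eq K (K ⊗[k] F) L]
    exact hL.comp hKF hLinj
  let := (isField_tensorProduct (E := E) hKL).toField
  let g : E ⊗[K] (K ⊗[k] F) →ₐ[K] E ⊗[K] L :=
    Algebra.TensorProduct.map (AlgHom.id K E) (IsScalarTower.toAlgHom K (K ⊗[k] F) L)
  have hg : IntClosed g.toRingHom :=
    PreservesIntClosed.of_smooth K E (K ⊗[k] F) L (IsScalarTower.toAlgHom K (K ⊗[k] F) L) hL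
  have hginj : Function.Injective g := Module.Flat.lTensor_preserves_injective_linearMap
    (IsScalarTower.toAlgHom K (K ⊗[k] F) L).toLinearMap hLinj
  have hdom : IsDomain (E ⊗[K] (K ⊗[k] F)) := hginj.isDomain g.toRingHom
  have hcl : IsIntegrallyClosed (E ⊗[K] (K ⊗[k] F)) := hg.isIntegrallyClosed hginj
  let e := (Algebra.TensorProduct.cancelBaseChange k K K E F).toRingEquiv
  exact ⟨e.symm.injective.isDomain e.symm.toRingHom, .of_equiv e⟩

lemma isIntegrallyClosed_tensorProduct_of_essFiniteType {k E F : Type u} [Field k] [Field E]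
    [Field F] [Algebra k E] [Algebra k F] (h : IsSeparableExtension k E) (p : ℕ) [Fact p.Prime]
    [CharP k p] [Algebra.EssFiniteType k E] (hF : IntClosed (algebraMap k F)) :
    IsDomain (E ⊗[k] F) ∧ IsIntegrallyClosed (E ⊗[k] F) := by
  obtain ⟨s, hs, _, _⟩ := h.exists_adjoin p
  obtain ⟨_, _⟩ := isIntegrallyClosed_tensorProduct_adjoin (F := F) s hs
  exact isIntegrallyClosed_tensorProduct_of_tower (PreservesIntClosed.adjoin s hs) hF

/-- If `k` is algebraically closed in the field `F` and `K / k` is separable, then `K ⊗ F` is an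
integrally closed domain. -/
theorem isIntegrallyClosed_tensorProduct {k K F : Type u} [Field k] [Field K]
    [Field F] [Algebra k K] [Algebra k F] (h : IsSeparableExtension k K) (p : ℕ) [Fact p.Prime]
    [CharP k p] (hF : IntClosed (algebraMap k F)) :
    IsDomain (K ⊗[k] F) ∧ IsIntegrallyClosed (K ⊗[k] F) := by
  have hfg (E : IntermediateField k K) (hE : E.FG) :
      IsDomain (E ⊗[k] F) ∧ IsIntegrallyClosed (E ⊗[k] F) :=
    have : Algebra.EssFiniteType k E := IntermediateField.essFiniteType_iff.mpr hE
    isIntegrallyClosed_tensorProduct_of_essFiniteType (h.of_injective E.val) p hF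
  have hdom : IsDomain (K ⊗[k] F) := by
    have : NoZeroDivisors (K ⊗[k] F) := by
      refine ⟨fun {a b} hab ↦ ?_⟩
      obtain ⟨E₁, hE₁, ha⟩ := exists_fg_mem_range a
      obtain ⟨E₂, hE₂, hb⟩ := exists_fg_mem_range b
      have hE := IntermediateField.fg_sup hE₁ hE₂
      have h₁ : E₁ ≤ E₁ ⊔ E₂ := le_sup_left
      have h₂ : E₂ ≤ E₁ ⊔ E₂ := le_sup_right
      generalize E₁ ⊔ E₂ = E at *
      have : NoZeroDivisors (E ⊗[k] F) := (hfg E hE).1.to_noZeroDivisors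
      obtain ⟨a, rfl⟩ := range_inclTensor_mono F h₁ ha
      obtain ⟨b, rfl⟩ := range_inclTensor_mono F h₂ hb
      have : a * b = 0 := inclTensor_injective F E
        ((map_mul _ _ _).trans (hab.trans (map_zero _).symm))
      rcases mul_eq_zero.mp this with rfl | rfl <;> simp
    exact NoZeroDivisors.to_isDomain _
  -- The divisibility criterion involves only `a`, `b` and the coefficients of `P`, all defined over
  -- one finitely generated subfield.
  refine ⟨hdom, isIntegrallyClosed_of_forall_dvd fun a b hb P hP hab ↦ ?_⟩
  obtain ⟨E₁, hE₁, ha⟩ := exists_fg_mem_range a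
  obtain ⟨E₂, hE₂, hb'⟩ := exists_fg_mem_range b
  obtain ⟨E₃, hE₃, hP'⟩ := exists_fg_map_eq P
  have hE := IntermediateField.fg_sup hE₁ (IntermediateField.fg_sup hE₂ hE₃)
  have h₁ : E₁ ≤ E₁ ⊔ (E₂ ⊔ E₃) := le_sup_left
  have h₂ : E₂ ≤ E₁ ⊔ (E₂ ⊔ E₃) := le_sup_left.trans le_sup_right
  have h₃ : E₃ ≤ E₁ ⊔ (E₂ ⊔ E₃) := le_sup_right.trans le_sup_right
  generalize E₁ ⊔ (E₂ ⊔ E₃) = E at *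
  obtain ⟨a, rfl⟩ := range_inclTensor_mono F h₁ ha
  obtain ⟨b, rfl⟩ := range_inclTensor_mono F h₂ hb'
  have hP'' : P ∈ Polynomial.lifts (inclTensor F E).toRingHom := by
    rw [Polynomial.lifts_iff_coeff_lifts] at hP' ⊢
    exact fun n ↦ range_inclTensor_mono F h₃ (hP' n)
  obtain ⟨Q, rfl, -, hQ⟩ := Polynomial.lifts_and_natDegree_eq_and_monic hP'' hP
  obtain ⟨_, _⟩ := hfg E hE
  have hb0 : b ≠ 0 := by
    rintro rfl
    exact hb (map_zero _)
  refine map_dvd (inclTensor F E).toRingHom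
    (dvd_of_eval_scaleRoots_eq_zero (R := E ⊗[k] F) hb0 hQ ?_)
  refine inclTensor_injective F E ((Polynomial.eval_map_apply _ _).symm.trans ?_)
  rw [map_zero, ← hab, ← Polynomial.map_scaleRoots _ _ _ ?_]
  rw [hQ.leadingCoeff]
  exact fun h ↦ one_ne_zero ((map_one _).symm.trans h)


/-! ### Sections of a base change -/

lemma le_preimage_top {X Y : Scheme.{u}} (f : X ⟶ Y) (U : X.Opens) : U ≤ f ⁻¹ᵁ ⊤ := le_top

/-- The homomorphism `R → Γ(X, U)` given by a morphism `X ⟶ Spec R`. -/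
noncomputable def toSections {R : Type u} [CommRing R] {X : Scheme.{u}}
    (α : X ⟶ Spec (CommRingCat.of R)) (U : X.Opens) : R →+* Γ(X, U) :=
  ((Scheme.ΓSpecIso (CommRingCat.of R)).inv ≫ α.appLE ⊤ U (le_preimage_top α U)).hom

lemma toFunctionField_eq_germ {R : Type u} [CommRing R] {X : Scheme.{u}} [IsIntegral X]
    (α : X ⟶ Spec (CommRingCat.of R)) (U : X.Opens) (hU : genericPoint X ∈ U) (r : R) :
    toFunctionField α r = X.presheaf.germ U (genericPoint X) hU (toSections α U r) := by
  have h : α.appTop ≫ X.presheaf.germ ⊤ (genericPoint X) trivial =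
      α.appLE ⊤ U (le_preimage_top α U) ≫ X.presheaf.germ U (genericPoint X) hU := by
    rw [Scheme.Hom.appLE, Category.assoc, X.presheaf.germ_res]
    rfl
  rw [toFunctionField, h]
  rfl

lemma toSections_app {R S : Type u} [CommRing R] [CommRing S] {X Y : Scheme.{u}}
    (α : X ⟶ Spec (CommRingCat.of R)) (β : Y ⟶ Spec (CommRingCat.of S)) (i : R →+* S) (f : Y ⟶ X)
    (h : f ≫ α = β ≫ specMap i) (U : X.Opens) (r : R) :
    f.app U (toSections α U r) = toSections β (f ⁻¹ᵁ U) (i r) := by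
  have h₁ : (Scheme.ΓSpecIso (CommRingCat.of R)).inv ≫ α.appLE ⊤ U (le_preimage_top α U) ≫ f.app U =
      CommRingCat.ofHom i ≫ (Scheme.ΓSpecIso (CommRingCat.of S)).inv ≫
        β.appLE ⊤ (f ⁻¹ᵁ U) (le_preimage_top _ _) := by
    have h₂ : (f ≫ α).appLE ⊤ (f ⁻¹ᵁ U) (le_preimage_top _ _) =
        (β ≫ specMap i).appLE ⊤ (f ⁻¹ᵁ U) (le_preimage_top _ _) := by
      congr 1
    rw [Scheme.ΓSpecIso_inv_naturality_assoc, ← Scheme.Hom.appLE_eq_app,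
      Scheme.Hom.appLE_comp_appLE, h₂, ← Scheme.Hom.appLE_comp_appLE _ _ ⊤ ⊤ _ (le_preimage_top _ _)
        (le_preimage_top _ _),
      Scheme.Hom.appTop, Scheme.Hom.app_eq_appLE]
    rfl
  exact congr($(h₁).hom r)

section BaseChange

variable {k K : Type u} [CommRing k] [CommRing K] [Algebra k K] {X Y : Scheme.{u}}
  {fst : Y ⟶ X} {snd : Y ⟶ Spec (CommRingCat.of K)} {α : X ⟶ Spec (CommRingCat.of k)}

lemma isPushout_toSections (sq : IsPullback fst snd α (specMap (algebraMap k K))) {U : X.Opens}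
    (hU : IsAffineOpen U) :
    IsPushout (CommRingCat.ofHom (toSections α U)) (CommRingCat.ofHom (algebraMap k K))
      (fst.app U) (CommRingCat.ofHom (toSections snd (fst ⁻¹ᵁ U))) := by
  have h := (isIso_pushoutSection_iff (US := ⊤) (UT := ⊤) (UX := U) (UY := fst ⁻¹ᵁ U)
    sq (le_preimage_top _ _) (le_preimage_top _ _) (by simp)).mp
    (isIso_pushoutSection_of_isAffineOpen sq (le_preimage_top _ _) (le_preimage_top _ _) (by simp)
      (isAffineOpen_top _)
      (isAffineOpen_top _) hU)
  refine .of_iso h (Scheme.ΓSpecIso (CommRingCat.of k)) (Iso.refl _)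
    (Scheme.ΓSpecIso (CommRingCat.of K)) (Iso.refl _) ?_ ?_ ?_ ?_
  · simp [toSections]
  · have : (specMap (algebraMap k K)).appLE ⊤ ⊤ (le_preimage_top _ _) =
        (specMap (algebraMap k K)).appTop := Scheme.Hom.appLE_eq_app _
    rw [this]
    exact Scheme.ΓSpecIso_naturality _
  · simp [Scheme.Hom.app_eq_appLE]
  · simp [toSections]

lemma exists_ringEquiv_sections (sq : IsPullback fst snd α (specMap (algebraMap k K)))
    {U : X.Opens} (hU : IsAffineOpen U) [Algebra k Γ(X, U)]
    (halg : algebraMap k Γ(X, U) = toSections α U) :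
    ∃ e : K ⊗[k] Γ(X, U) ≃+* Γ(Y, fst ⁻¹ᵁ U), (∀ c, e (c ⊗ₜ 1) = toSections snd (fst ⁻¹ᵁ U) c) ∧
      ∀ s, e (1 ⊗ₜ s) = fst.app U s := by
  have h₁ := isPushout_toSections sq hU
  rw [← halg] at h₁
  have h₂ := CommRingCat.isPushout_tensorProduct k K Γ(X, U)
  let e := (h₂.flip.isoIsPushout _ _ h₁)
  refine ⟨e.commRingCatIsoToRingEquiv, fun c ↦ ?_, fun s ↦ ?_⟩
  · exact congr($(h₂.flip.inr_isoIsPushout_hom _ _ h₁).hom c)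
  · exact congr($(h₂.flip.inl_isoIsPushout_hom _ _ h₁).hom s)

end BaseChange


/-! ### Integral and normal schemes -/

lemma isPreirreducible_of_isAffineOpen {X : Scheme.{u}} {V : X.Opens} (hV : IsAffineOpen V)
    [IsDomain Γ(X, V)] : (V : Set X).Nonempty ∧ IsPreirreducible (V : Set X) := by
  have : IsAffine V := hV
  have hdom : IsDomain Γ(V, ⊤) := V.topIso.commRingCatIsoToRingEquiv.toMulEquiv.isDomain _
  have hne : (V : Set X).Nonempty := by
    by_contra h
    rw [Set.not_nonempty_iff_eq_empty] at h
    have hb : V = ⊥ := by ext1; simpa using h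
    subst hb
    exact not_subsingleton Γ(X, ⊥) inferInstance
  have : Nonempty V := hne.to_subtype
  have : IsIntegral V := isIntegral_of_isAffine_of_isDomain _
  refine ⟨hne, ?_⟩
  rw [isPreirreducible_iff_preirreducibleSpace]
  exact (irreducibleSpace_of_isIntegral (X := V)).toPreirreducibleSpace

lemma exists_isAffineOpen_le {X : Scheme.{u}} {U : X.Opens} {x : X} (hx : x ∈ U) :
    ∃ W : X.Opens, IsAffineOpen W ∧ x ∈ W ∧ W ≤ U := by
  obtain ⟨W, hW, hxW, hWU⟩ := X.isBasis_affineOpens.exists_subset_of_mem_open hx U.isOpen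
  obtain ⟨W, hW, rfl⟩ := hW
  exact ⟨W, hW, hxW, hWU⟩

/-- The preimages of nonempty affine opens are nonempty and irreducible, and any two of them meet
over a smaller affine open since `X` is irreducible. So two nonempty opens of `Y` both meet one such
small preimage, hence each other. -/
lemma isIntegral_of_isAffineHom {X Y : Scheme.{u}} (f : Y ⟶ X) [IsAffineHom f] [IsIntegral X]
    (h : ∀ U : X.Opens, IsAffineOpen U → (U : Set X).Nonempty → IsDomain Γ(Y, f ⁻¹ᵁ U)) :
    IsIntegral Y := by
  have hpre (U : X.Opens) (hU : IsAffineOpen U) (hne : (U : Set X).Nonempty) :=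
    have := h U hU hne
    isPreirreducible_of_isAffineOpen (hU.preimage f)
  have hred : IsReduced Y := by
    have (y : Y) : _root_.IsReduced (Y.presheaf.stalk y) := by
      obtain ⟨U, hU, hyU, -⟩ := exists_isAffineOpen_le (X := X) (U := ⊤) (x := f y) trivial
      have := h U hU ⟨_, hyU⟩
      let := Y.presheaf.algebra_section_stalk (⟨y, hyU⟩ : f ⁻¹ᵁ U)
      have := (hU.preimage f).isLocalization_stalk ⟨y, hyU⟩
      have : IsDomain (Y.presheaf.stalk y) := IsLocalization.isDomain_of_le_nonZeroDivisors _
        ((hU.preimage f).primeIdealOf ⟨y, hyU⟩).asIdeal.primeCompl_le_nonZeroDivisors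
      infer_instance
    exact isReduced_of_isReduced_stalk Y
  have hirr : IrreducibleSpace Y := by
    obtain ⟨x⟩ := (inferInstance : Nonempty X)
    obtain ⟨U, hU, hxU, -⟩ := exists_isAffineOpen_le (X := X) (U := ⊤) (x := x) trivial
    have : Nonempty Y := ⟨(hpre U hU ⟨_, hxU⟩).1.some⟩
    have : PreirreducibleSpace Y := by
      refine ⟨fun O₁ O₂ hO₁ hO₂ ⟨y₁, _, hy₁⟩ ⟨y₂, _, hy₂⟩ ↦ ?_⟩
      obtain ⟨U₁, hU₁, hyU₁, -⟩ := exists_isAffineOpen_le (X := X) (U := ⊤) (x := f y₁) trivial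
      obtain ⟨U₂, hU₂, hyU₂, -⟩ := exists_isAffineOpen_le (X := X) (U := ⊤) (x := f y₂) trivial
      obtain ⟨x, hx₁, hx₂⟩ := nonempty_preirreducible_inter U₁.isOpen U₂.isOpen ⟨_, hyU₁⟩ ⟨_, hyU₂⟩
      obtain ⟨W, hW, hxW, hWU⟩ := exists_isAffineOpen_le (X := X) (U := U₁ ⊓ U₂) ⟨hx₁, hx₂⟩
      obtain ⟨⟨w, hw⟩, hWirr⟩ := hpre W hW ⟨_, hxW⟩
      have meets (O : Set Y) (hO : IsOpen O) (y : Y) (hy : y ∈ O) (V : X.Opens)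
          (hV : IsAffineOpen V) (hyV : f y ∈ V) (hWV : W ≤ V) :
          ((f ⁻¹ᵁ W : Set Y) ∩ O).Nonempty := by
        obtain ⟨z, -, hz₁, hz₂⟩ := (hpre V hV ⟨_, hyV⟩).2 (f ⁻¹ᵁ W) O (f ⁻¹ᵁ W).isOpen hO
          ⟨w, hWV hw, hw⟩ ⟨y, hyV, hy⟩
        exact ⟨z, hz₁, hz₂⟩
      obtain ⟨z, -, hz⟩ := hWirr O₁ O₂ hO₁ hO₂
        (meets O₁ hO₁ y₁ hy₁ U₁ hU₁ hyU₁ (hWU.trans inf_le_left))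
        (meets O₂ hO₂ y₂ hy₂ U₂ hU₂ hyU₂ (hWU.trans inf_le_right))
      exact ⟨z, trivial, hz⟩
    exact ⟨inferInstance⟩
  exact isIntegral_of_irreducibleSpace_of_isReduced Y

lemma IsNormal.isIntegrallyClosed {X : Scheme.{u}} [IsIntegral X] (h : IsNormal X) {U : X.Opens}
    (hU : IsAffineOpen U) [Nonempty U] : IsIntegrallyClosed Γ(X, U) := by
  refine IsIntegrallyClosed.of_localization_maximal fun P _ hP ↦ ?_
  let y : PrimeSpectrum Γ(X, U) := ⟨P, hP.isPrime⟩
  have hy : hU.fromSpec y ∈ U := (hU.isoSpec.inv y).2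
  let : Algebra Γ(X, U) (X.presheaf.stalk (hU.fromSpec y)) :=
    X.presheaf.algebra_section_stalk (⟨hU.fromSpec y, hy⟩ : U)
  have : IsLocalization.AtPrime (X.presheaf.stalk (hU.fromSpec y)) P :=
    hU.isLocalization_stalk' y hy
  have := (h (hU.fromSpec y)).2
  exact .of_equiv (IsLocalization.algEquiv P.primeCompl (X.presheaf.stalk (hU.fromSpec y))
    (Localization.AtPrime P)).toRingEquiv

lemma isNormal_of_isAffineOpen {X : Scheme.{u}} [IsIntegral X]
    (h : ∀ x : X, ∃ U : X.Opens, x ∈ U ∧ IsAffineOpen U ∧ IsIntegrallyClosed Γ(X, U)) :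
    IsNormal X := by
  intro x
  refine ⟨inferInstance, ?_⟩
  obtain ⟨U, hxU, hU, hcl⟩ := h x
  have : Nonempty U := ⟨⟨x, hxU⟩⟩
  let := X.presheaf.algebra_section_stalk (⟨x, hxU⟩ : U)
  have := hU.isLocalization_stalk ⟨x, hxU⟩
  exact isIntegrallyClosed_of_isLocalization (R := Γ(X, U)) _ _
    (hU.primeIdealOf ⟨x, hxU⟩).asIdeal.primeCompl_le_nonZeroDivisors


/-! ### Function fields -/

lemma map_genericPoint_of_surjective {X Y : Scheme.{u}} [IsIntegral X] [IsIntegral Y] (f : Y ⟶ X)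
    [Surjective f] : f (genericPoint Y) = genericPoint X := by
  have h := (genericPoint_spec Y).image f.continuous
  rw [Set.image_univ, f.surjective.range_eq, closure_univ] at h
  exact h.eq (genericPoint_spec X)

/-- The extension of function fields given by a dominant morphism of integral schemes. -/
noncomputable def functionFieldMap {X Y : Scheme.{u}} [IsIntegral X] [IsIntegral Y] (f : Y ⟶ X)
    (h : f (genericPoint Y) = genericPoint X) : X.functionField →+* Y.functionField :=
  (X.presheaf.stalkSpecializes (specializes_of_eq h) ≫ f.stalkMap (genericPoint Y)).hom

section

variable {X Y : Scheme.{u}} [IsIntegral X] [IsIntegral Y] (f : Y ⟶ X)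
    (h : f (genericPoint Y) = genericPoint X)

include h in
lemma genericPoint_mem {U : X.Opens} (hU : genericPoint X ∈ U) : genericPoint Y ∈ f ⁻¹ᵁ U := by
  change f (genericPoint Y) ∈ U
  rwa [h]

lemma functionFieldMap_germ (U : X.Opens) (hU : genericPoint X ∈ U) (s : Γ(X, U)) :
    functionFieldMap f h (X.presheaf.germ U (genericPoint X) hU s) =
      Y.presheaf.germ (f ⁻¹ᵁ U) (genericPoint Y) (genericPoint_mem f h hU) (f.app U s) := by
  have : X.presheaf.germ U (genericPoint X) hU ≫
      X.presheaf.stalkSpecializes (specializes_of_eq h) ≫ f.stalkMap (genericPoint Y) =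
      f.app U ≫ Y.presheaf.germ (f ⁻¹ᵁ U) (genericPoint Y) (genericPoint_mem f h hU) := by
    rw [TopCat.Presheaf.germ_stalkSpecializes_assoc, Scheme.Hom.germ_stalkMap]
  exact congr($(this).hom s)

lemma isIso_stalkMap_iff_bijective :
    IsIso (f.stalkMap (genericPoint Y)) ↔ Function.Bijective (functionFieldMap f h) := by
  have : IsIso (X.presheaf.stalkSpecializes (specializes_of_eq h)) := by
    exact (X.presheaf.stalkCongr (.of_eq h)).symm.isIso_hom
  rw [← isIso_comp_left_iff (X.presheaf.stalkSpecializes (specializes_of_eq h))]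
  exact ConcreteCategory.isIso_iff_bijective _

lemma functionFieldMap_toFunctionField {R S : Type u} [CommRing R] [CommRing S]
    (α : X ⟶ Spec (CommRingCat.of R)) (β : Y ⟶ Spec (CommRingCat.of S)) (i : R →+* S)
    (w : f ≫ α = β ≫ specMap i) (r : R) :
    functionFieldMap f h (toFunctionField α r) = toFunctionField β (i r) := by
  have hx : genericPoint X ∈ (⊤ : X.Opens) := trivial
  rw [toFunctionField_eq_germ α ⊤ hx, functionFieldMap_germ, toSections_app α β i f w,
    toFunctionField_eq_germ β _ (genericPoint_mem f h hx)]

end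

lemma exists_isAffineOpen_genericPoint (X : Scheme.{u}) [IsIntegral X] :
    ∃ U : X.Opens, IsAffineOpen U ∧ genericPoint X ∈ U := by
  obtain ⟨U, hU, hx, -⟩ := exists_isAffineOpen_le (U := (⊤ : X.Opens)) (x := genericPoint X) trivial
  exact ⟨U, hU, hx⟩

lemma exists_eq_germ_div_germ {X : Scheme.{u}} [IsIntegral X] {U : X.Opens} (hU : IsAffineOpen U)
    (hx : genericPoint X ∈ U) (q : X.functionField) :
    ∃ a b : Γ(X, U), X.presheaf.germ U (genericPoint X) hx b ≠ 0 ∧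
      q = X.presheaf.germ U (genericPoint X) hx a / X.presheaf.germ U (genericPoint X) hx b := by
  have : Nonempty U := ⟨⟨_, hx⟩⟩
  have := functionField_isFractionRing_of_isAffineOpen X U hU
  obtain ⟨a, b, hb, rfl⟩ := IsFractionRing.div_surjective (A := Γ(X, U)) q
  exact ⟨a, b, (map_ne_zero_iff _ (germ_injective_of_isIntegral X _ hx)).mpr
    (nonZeroDivisors.ne_zero hb), rfl⟩

section BaseChange

variable {k K : Type u} [CommRing k] [CommRing K] [Algebra k K] {X Y : Scheme.{u}}
  {fst : Y ⟶ X} {snd : Y ⟶ Spec (CommRingCat.of K)} {α : X ⟶ Spec (CommRingCat.of k)}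

/-- `K(Y)` is the field of fractions of `K ⊗ K(X)`: both rings have the same fractions as `K ⊗ Γ(X,
U)` for an affine `U`. -/
lemma exists_tensorProduct_functionField (sq : IsPullback fst snd α (specMap (algebraMap k K)))
    [IsIntegral X] [IsIntegral Y] (h : fst (genericPoint Y) = genericPoint X)
    [Algebra k X.functionField] (halg : algebraMap k X.functionField = toFunctionField α) :
    ∃ Φ : K ⊗[k] X.functionField →+* Y.functionField,
      (∀ c f, Φ (c ⊗ₜ f) = toFunctionField snd c * functionFieldMap fst h f) ∧
      Function.Injective Φ ∧ ∀ q, ∃ a b, Φ b ≠ 0 ∧ q = Φ a / Φ b := by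
  let : Algebra k Y.functionField := ((toFunctionField snd).comp (algebraMap k K)).toAlgebra
  let ψ₁ : K →ₐ[k] Y.functionField := ⟨toFunctionField snd, fun _ ↦ rfl⟩
  let ψ₂ : X.functionField →ₐ[k] Y.functionField := ⟨functionFieldMap fst h, fun r ↦ by
    rw [halg]
    exact functionFieldMap_toFunctionField fst h α snd (algebraMap k K) sq.w r⟩
  let Φ := Algebra.TensorProduct.productMap ψ₁ ψ₂
  have hΦ (c f) : Φ (c ⊗ₜ f) = toFunctionField snd c * functionFieldMap fst h f := by
    simp [Φ, ψ₁, ψ₂]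
  obtain ⟨U, hU, hx⟩ := exists_isAffineOpen_genericPoint X
  have hfst : IsAffineHom fst := MorphismProperty.of_isPullback sq.flip inferInstance
  have hy := genericPoint_mem fst h hx
  let : Algebra k Γ(X, U) := (toSections α U).toAlgebra
  obtain ⟨e, he₁, he₂⟩ := exists_ringEquiv_sections sq hU rfl
  let j : Γ(X, U) →ₐ[k] X.functionField := ⟨(X.presheaf.germ U (genericPoint X) hx).hom, fun r ↦ by
    rw [halg, toFunctionField_eq_germ α U hx]; rfl⟩
  let J := Algebra.TensorProduct.map (AlgHom.id k K) j
  have hJ (w : K ⊗[k] Γ(X, U)) :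
      Φ (J w) = Y.presheaf.germ (fst ⁻¹ᵁ U) (genericPoint Y) hy (e w) := by
    induction w with
    | zero => simp
    | add a b ha hb => simp only [map_add, ha, hb]
    | tmul c s =>
      have : c ⊗ₜ[k] s = c ⊗ₜ 1 * 1 ⊗ₜ s := by simp
      have h₁ : Φ (J (c ⊗ₜ s)) = toFunctionField snd c * functionFieldMap fst h (j s) := by
        simp only [J, Algebra.TensorProduct.map_tmul]
        exact hΦ _ _
      rw [h₁, this, map_mul e, he₁, he₂, map_mul, toFunctionField_eq_germ snd _ hy]
      congr 1
      exact functionFieldMap_germ fst h U hx s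
  -- A tensor involves finitely many elements of `K(X)`, so a common denominator from `Γ(X, U)`
  -- clears it.
  have hclear (z : K ⊗[k] X.functionField) : ∃ s : Γ(X, U), j s ≠ 0 ∧
      ∃ w, z * (1 ⊗ₜ j s) = J w := by
    induction z with
    | zero => exact ⟨1, by simp, 0, by simp⟩
    | add a b ha hb =>
      obtain ⟨s, hs, v, hv⟩ := ha
      obtain ⟨t, ht, w, hw⟩ := hb
      refine ⟨s * t, by simp [hs, ht], v * 1 ⊗ₜ t + w * 1 ⊗ₜ s, ?_⟩
      have : (1 : K) ⊗ₜ[k] (j s * j t) = 1 ⊗ₜ j s * 1 ⊗ₜ j t := by simp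
      simp only [map_add, map_mul, this, ← hv, ← hw]
      simp only [J, Algebra.TensorProduct.map_tmul, map_one]
      ring
    | tmul c f =>
      obtain ⟨a, b, hb, rfl⟩ := exists_eq_germ_div_germ hU hx f
      refine ⟨b, hb, c ⊗ₜ a, ?_⟩
      rw [Algebra.TensorProduct.tmul_mul_tmul, mul_one]
      simp only [J, Algebra.TensorProduct.map_tmul]
      congr 1
      exact div_mul_cancel₀ _ hb
  refine ⟨Φ.toRingHom, hΦ, ?_, fun q ↦ ?_⟩
  · refine (injective_iff_map_eq_zero _).mpr fun z hz ↦ ?_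
    obtain ⟨s, hs, w, hw⟩ := hclear z
    have hw0 : w = 0 := by
      apply e.injective
      apply germ_injective_of_isIntegral Y (genericPoint Y) hy
      rw [← hJ, ← hw, map_mul, map_zero, map_zero]
      exact mul_eq_zero_of_left hz _
    have : z = z * (1 ⊗ₜ j s) * (1 ⊗ₜ (j s)⁻¹) := by
      rw [mul_assoc, Algebra.TensorProduct.tmul_mul_tmul, mul_inv_cancel₀ hs, mul_one,
        ← Algebra.TensorProduct.one_def, mul_one]
    rw [this, hw, hw0, map_zero, zero_mul]
  · obtain ⟨a, b, hb, rfl⟩ := exists_eq_germ_div_germ (hU.preimage fst) hy q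
    refine ⟨J (e.symm a), J (e.symm b), ?_, ?_⟩
    · change Φ _ ≠ 0
      rwa [hJ, e.apply_symm_apply]
    · change _ = Φ _ / Φ _
      rw [hJ, hJ, e.apply_symm_apply, e.apply_symm_apply]

end BaseChange

lemma isAlgebraicElem_iff_isIntegralElem {k S : Type u} [Field k] [CommRing S] (i : k →+* S)
    (x : S) : IsAlgebraicElem i x ↔ i.IsIntegralElem x := by
  let := i.toAlgebra
  exact isAlgebraic_iff_isIntegral (K := k) (x := x)


/-! ### Base change of integral and normal schemes over a field -/

lemma functionFieldMap_comp {X Y Z : Scheme.{u}} [IsIntegral X] [IsIntegral Y] [IsIntegral Z]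
    (f : Y ⟶ X) (g : X ⟶ Z) (e : Y ⟶ Z) (w : f ≫ g = e)
    (hf : f (genericPoint Y) = genericPoint X) (hg : g (genericPoint X) = genericPoint Z)
    (he : e (genericPoint Y) = genericPoint Z) (q : Z.functionField) :
    functionFieldMap e he q = functionFieldMap f hf (functionFieldMap g hg q) := by
  subst w
  obtain ⟨U, hU, s, rfl⟩ := Z.presheaf.exists_germ_eq q
  rw [functionFieldMap_germ, functionFieldMap_germ, functionFieldMap_germ]
  simp
  rfl

section Field

variable {k K : Type u} [Field k] [CommRing K] [Algebra k K] {X Y : Scheme.{u}}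
  {fst : Y ⟶ X} {snd : Y ⟶ Spec (CommRingCat.of K)} {α : X ⟶ Spec (CommRingCat.of k)}

lemma surjective_fst (sq : IsPullback fst snd α (specMap (algebraMap k K))) [Nontrivial K] :
    Surjective fst := by
  have : Surjective (specMap (algebraMap k K)) :=
    ((flat_and_surjective_SpecMap_iff (CommRingCat.ofHom (algebraMap k K))).mpr
      (RingHom.faithfullyFlat_algebraMap_iff.mpr inferInstance)).2
  exact MorphismProperty.of_isPullback sq.flip this

variable [IsIntegral X] [Algebra k X.functionField]
  (halg : algebraMap k X.functionField = toFunctionField α)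

include halg in
lemma exists_sections_injection (sq : IsPullback fst snd α (specMap (algebraMap k K))) {U : X.Opens}
    (hU : IsAffineOpen U) (hne : (U : Set X).Nonempty) [Algebra k Γ(X, U)]
    (halgU : algebraMap k Γ(X, U) = toSections α U) :
    ∃ j : Γ(X, U) →ₐ[k] X.functionField,
      Function.Injective (Algebra.TensorProduct.map (AlgHom.id k K) j) ∧
      (∀ s, j s = X.germToFunctionField (h := hne.to_subtype) U s) ∧
      Nonempty (K ⊗[k] Γ(X, U) ≃+* Γ(Y, fst ⁻¹ᵁ U)) := by
  have hx : genericPoint X ∈ U :=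
    ((genericPoint_spec X).mem_open_set_iff U.isOpen).mpr (by simpa using hne)
  let j : Γ(X, U) →ₐ[k] X.functionField := ⟨(X.presheaf.germ U (genericPoint X) hx).hom, fun r ↦ by
    rw [halg, halgU, toFunctionField_eq_germ α U hx]; rfl⟩
  have hj : Function.Injective j := germ_injective_of_isIntegral X (genericPoint X) hx
  refine ⟨j, Module.Flat.lTensor_preserves_injective_linearMap j.toLinearMap hj, fun _ ↦ rfl, ?_⟩
  obtain ⟨e, -⟩ := exists_ringEquiv_sections sq hU halgU
  exact ⟨e⟩

include halg in
theorem isIntegral_of_isPullback (sq : IsPullback fst snd α (specMap (algebraMap k K)))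
    [IsDomain (K ⊗[k] X.functionField)] : IsIntegral Y := by
  have : IsAffineHom fst := MorphismProperty.of_isPullback sq.flip inferInstance
  refine isIntegral_of_isAffineHom fst fun U hU hne ↦ ?_
  let : Algebra k Γ(X, U) := (toSections α U).toAlgebra
  obtain ⟨j, hj, -, ⟨e⟩⟩ := exists_sections_injection halg sq hU hne rfl
  have : IsDomain (K ⊗[k] Γ(X, U)) :=
    hj.isDomain (Algebra.TensorProduct.map (AlgHom.id k K) j).toRingHom
  exact e.symm.toMulEquiv.isDomain _

include halg in
theorem isNormal_of_isPullback (sq : IsPullback fst snd α (specMap (algebraMap k K)))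
    [IsIntegral Y] [IsDomain (K ⊗[k] X.functionField)]
    [IsIntegrallyClosed (K ⊗[k] X.functionField)] (hK : PreservesIntClosed k K)
    (hX : IsNormal X) : IsNormal Y := by
  have : IsAffineHom fst := MorphismProperty.of_isPullback sq.flip inferInstance
  refine isNormal_of_isAffineOpen fun y ↦ ?_
  obtain ⟨U, hU, hyU, -⟩ := exists_isAffineOpen_le (U := (⊤ : X.Opens)) (x := fst y) trivial
  refine ⟨fst ⁻¹ᵁ U, hyU, hU.preimage fst, ?_⟩
  have hne : (U : Set X).Nonempty := ⟨_, hyU⟩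
  have : Nonempty U := hne.to_subtype
  let : Algebra k Γ(X, U) := (toSections α U).toAlgebra
  obtain ⟨j, hj, hj', ⟨e⟩⟩ := exists_sections_injection halg sq hU hne rfl
  have : IsDomain (K ⊗[k] Γ(X, U)) :=
    hj.isDomain (Algebra.TensorProduct.map (AlgHom.id k K) j).toRingHom
  have := functionField_isFractionRing_of_isAffineOpen X U hU
  have := hX.isIntegrallyClosed hU
  have hcl : IntClosed (algebraMap Γ(X, U) X.functionField) := fun x hx ↦
    IsIntegrallyClosed.isIntegral_iff.mp hx
  have heq : j.toRingHom = algebraMap Γ(X, U) X.functionField := RingHom.ext hj'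
  have : IsIntegrallyClosed (K ⊗[k] Γ(X, U)) :=
    (hK _ _ j (heq ▸ hcl)).isIntegrallyClosed hj
  exact .of_equiv e

include halg in
-- An element of `K(Y)` integral over `K` lies in `K ⊗ K(X)`, which is integrally closed with
-- fraction field `K(Y)`; there `K` is integrally closed by base change.
theorem intClosed_toFunctionField (sq : IsPullback fst snd α (specMap (algebraMap k K)))
    [IsIntegral Y] [IsDomain (K ⊗[k] X.functionField)]
    [IsIntegrallyClosed (K ⊗[k] X.functionField)] (hK : PreservesIntClosed k K) [Nontrivial K]
    (hα : IntClosed (toFunctionField α)) : IntClosed (toFunctionField snd) := by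
  have := surjective_fst sq
  obtain ⟨Φ, hΦ, hinj, hfrac⟩ :=
    exists_tensorProduct_functionField sq (map_genericPoint_of_surjective fst) halg
  let : Algebra (K ⊗[k] X.functionField) Y.functionField := Φ.toAlgebra
  have : FaithfulSMul (K ⊗[k] X.functionField) Y.functionField :=
    (faithfulSMul_iff_algebraMap_injective _ _).mpr hinj
  have : IsFractionRing (K ⊗[k] X.functionField) Y.functionField := .of_field _ _ fun z ↦ by
    obtain ⟨a, b, -, h⟩ := hfrac z
    exact ⟨a, b, h⟩
  have hcl : IntClosed Φ := fun x hx ↦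
    IsIntegrallyClosed.isIntegral_iff (R := K ⊗[k] X.functionField).mp hx
  have heq : toFunctionField snd = Φ.comp (algebraMap K (K ⊗[k] X.functionField)) := by
    ext c
    simp [hΦ, Algebra.TensorProduct.algebraMap_apply]
  rw [heq]
  exact hcl.comp (hK.includeLeft (halg ▸ hα)) hinj

include halg in
-- By additivity of Frobenius it suffices to treat pure tensors in `K ⊗ K(X)`, then quotients.
lemma pow_mem_range_functionFieldMap (sq : IsPullback fst snd α (specMap (algebraMap k K)))
    [IsIntegral Y] (p : ℕ) [Fact p.Prime] [CharP k p]
    (hp : ∀ x : K, x ^ p ∈ (algebraMap k K).range) (h : fst (genericPoint Y) = genericPoint X)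
    (q : Y.functionField) : q ^ p ∈ (functionFieldMap fst h).range := by
  obtain ⟨Φ, hΦ, hinj, hfrac⟩ := exists_tensorProduct_functionField sq h halg
  have : CharP Y.functionField p := charP_of_injective_ringHom
    ((functionFieldMap fst h).comp (algebraMap k X.functionField)).injective p
  have hmem (a) : Φ a ^ p ∈ (functionFieldMap fst h).fieldRange := by
    induction a with
    | zero => simp [(Fact.out : p.Prime).ne_zero]
    | add a b ha hb =>
      rw [map_add, add_pow_char]
      exact add_mem ha hb
    | tmul c f =>
      obtain ⟨r, hr⟩ := hp c
      rw [hΦ, mul_pow, ← map_pow, ← map_pow, ← hr,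
        ← functionFieldMap_toFunctionField fst h α snd (algebraMap k K) sq.w]
      exact mul_mem ⟨_, rfl⟩ ⟨_, rfl⟩
  obtain ⟨a, b, -, rfl⟩ := hfrac q
  change _ ∈ (functionFieldMap fst h).fieldRange
  rw [div_pow]
  exact div_mem (hmem a) (hmem b)

end Field

/-! ### Base change of a normalisation -/

lemma IsNormalization.surjective {Y Z : Scheme.{u}} {ν : Y ⟶ Z} (h : IsNormalization ν) :
    Surjective ν := by
  have := h.isIntegral_source
  have := h.isIntegral_target
  have := h.isIntegralHom
  have hc : IsClosed (Set.range ν) := ν.isClosedMap.isClosed_range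
  refine ⟨Set.range_eq_univ.mp (Set.eq_univ_of_univ_subset ?_)⟩
  rw [← (genericPoint_spec Z).def]
  exact hc.closure_subset_iff.mpr (by
    rintro _ rfl
    exact ⟨_, h.map_genericPoint⟩)

/-- Only normality of `Y` is a real condition: integral morphisms are stable under base change, and
`K(Y)` is generated by `K` and `K(X) = K(Z)`, both of which come from `K(Z₁)`. -/
theorem IsNormalization.of_isPullback {k K : Type u} [Field k] [CommRing K] [Algebra k K]
    [Nontrivial K] {X Z Y Z₁ : Scheme.{u}} {ν : X ⟶ Z} {β : Z ⟶ Spec (CommRingCat.of k)}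
    {g : Z₁ ⟶ Z} {z : Z₁ ⟶ Spec (CommRingCat.of K)} {f : Y ⟶ X} {y : Y ⟶ Spec (CommRingCat.of K)}
    {ν₁ : Y ⟶ Z₁} (hν : IsNormalization ν) (sqZ : IsPullback g z β (specMap (algebraMap k K)))
    (sqX : IsPullback f y (ν ≫ β) (specMap (algebraMap k K))) (w : ν₁ ≫ g = f ≫ ν)
    (wy : ν₁ ≫ z = y) [IsIntegral Y] (hY : IsNormal Y) : IsNormalization ν₁ := by
  have := hν.isIntegral_source
  have := hν.isIntegral_target
  have := hν.isIntegralHom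
  have := hν.surjective
  subst wy
  have sq : IsPullback f ν₁ ν g := .of_bot sqX w.symm sqZ
  have := surjective_fst sqX
  have := surjective_fst sqZ
  have hf := map_genericPoint_of_surjective f
  have hν₀ := map_genericPoint_of_surjective ν
  let : Algebra k X.functionField := (toFunctionField (ν ≫ β)).toAlgebra
  let : Algebra k Z.functionField := (toFunctionField β).toAlgebra
  obtain ⟨Φ, hΦ, hinj, hfrac⟩ := exists_tensorProduct_functionField sqX hf rfl
  have hbij := (isIso_stalkMap_iff_bijective ν hν₀).mp hν.isIso_stalkMap
  let ι : Z.functionField →ₐ[k] X.functionField := ⟨functionFieldMap ν hν₀, fun r ↦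
    functionFieldMap_toFunctionField ν hν₀ β (ν ≫ β) (RingHom.id k) (by simp [specMap]) r⟩
  have hdom : IsDomain (K ⊗[k] X.functionField) := hinj.isDomain Φ
  -- `K ⊗ K(Z)` embeds in `K ⊗ K(X)`, hence in `K(Y)`; this makes `Z₁` integral.
  have hdom' : IsDomain (K ⊗[k] Z.functionField) :=
    Function.Injective.isDomain (Algebra.TensorProduct.map (AlgHom.id k K) ι).toRingHom
      (Module.Flat.lTensor_preserves_injective_linearMap ι.toLinearMap hbij.1)
  have hZ₁ : IsIntegral Z₁ := isIntegral_of_isPullback rfl sqZ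
  have : IsIntegralHom ν₁ := MorphismProperty.of_isPullback sq ‹IsIntegralHom ν›
  have : Surjective ν₁ := MorphismProperty.of_isPullback sq ‹Surjective ν›
  have hν₁ := map_genericPoint_of_surjective ν₁
  have hg := map_genericPoint_of_surjective g
  refine ⟨hY, inferInstance, hν₁, (isIso_stalkMap_iff_bijective ν₁ hν₁).mpr
    ⟨RingHom.injective _, fun q ↦ ?_⟩⟩
  have hmem (a) : Φ a ∈ (functionFieldMap ν₁ hν₁).fieldRange := by
    induction a with
    | zero => simp
    | add a b ha hb =>
      rw [map_add]
      exact add_mem ha hb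
    | tmul c x =>
      obtain ⟨x, rfl⟩ := hbij.2 x
      have he : (f ≫ ν) (genericPoint Y) = genericPoint Z := by simp [hf, hν₀]
      rw [hΦ, ← functionFieldMap_comp f ν (f ≫ ν) rfl hf hν₀ he,
        functionFieldMap_comp ν₁ g (f ≫ ν) w hν₁ hg he]
      refine mul_mem ⟨toFunctionField z c, ?_⟩ ⟨_, rfl⟩
      exact functionFieldMap_toFunctionField ν₁ hν₁ z (ν₁ ≫ z) (RingHom.id K) (by simp [specMap]) c
  obtain ⟨a, b, -, rfl⟩ := hfrac q
  exact div_mem (hmem a) (hmem b)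


/-! ### Purely inseparable extensions of exponent one and separable base change -/

section PurelyInseparable

variable {k l K : Type u} [Field k] [Field l] [Field K] [Algebra k l] [Algebra k K] (p : ℕ)
  [Fact p.Prime] [CharP k p]

lemma pow_mem_range_inclRight (h : ∀ x : l, x ^ p ∈ (algebraMap k l).range) (x : l ⊗[k] K) :
    x ^ p ∈ (inclRight (k := k) K l).range := by
  have : CharP (l ⊗[k] K) p := charP_of_injective_algebraMap (algebraMap k (l ⊗[k] K)).injective p
  induction x with
  | zero => simp [(Fact.out : p.Prime).ne_zero]
  | add a b ha hb =>
    rw [add_pow_char]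
    exact add_mem ha hb
  | tmul a b =>
    obtain ⟨c, hc⟩ := h a
    refine ⟨c • b ^ p, ?_⟩
    rw [Algebra.TensorProduct.tmul_pow, ← hc, Algebra.algebraMap_eq_smul_one,
      TensorProduct.smul_tmul]
    rfl

/-- By reducedness a nonzero `x` has nonzero `x ^ p`, which lies in the field `K` and is therefore
invertible. -/
lemma isField_tensorProduct_of_pow_mem (hK : IsSeparableExtension k K)
    (h : ∀ x : l, x ^ p ∈ (algebraMap k l).range) : IsField (l ⊗[k] K) := by
  have := hK l
  refine ⟨⟨0, 1, zero_ne_one⟩, mul_comm, fun {x} hx ↦ ?_⟩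
  obtain ⟨c, hc⟩ := pow_mem_range_inclRight p h x
  have hc0 : c ≠ 0 := by
    rintro rfl
    exact pow_ne_zero p hx (by rw [← hc, map_zero])
  refine ⟨x ^ (p - 1) * inclRight (k := k) K l c⁻¹, ?_⟩
  rw [← mul_assoc, ← pow_succ', Nat.sub_add_cancel (Fact.out : p.Prime).one_le, ← hc, ← map_mul,
    mul_inv_cancel₀ hc0, map_one]

/-- Separability of `l ⊗ K` over `l`, by `F ⊗[l] (l ⊗[k] K) = F ⊗[k] K`. -/
lemma IsSeparableExtension.baseChange_isReduced (hK : IsSeparableExtension k K) (F : Type u)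
    [Field F] [Algebra l F] : IsReduced (F ⊗[l] (l ⊗[k] K)) := by
  let : Algebra k F := Algebra.compHom F (algebraMap k l)
  have : IsScalarTower k l F := .of_algebraMap_eq fun _ ↦ rfl
  have := hK F
  exact isReduced_of_injective (Algebra.TensorProduct.cancelBaseChange k l l F K)
    (AlgEquiv.injective _)

end PurelyInseparable

lemma isIntegrallyClosed_tensorProduct_of_isField {k K : Type u} [Field k] [inst : CommRing K]
    [Algebra k K] (hf : IsField K) (p : ℕ) [Fact p.Prime] [CharP k p]
    (hK : ∀ (F : Type u) [Field F] [Algebra k F], IsReduced (F ⊗[k] K)) :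
    PreservesIntClosed k K ∧ ∀ (F : Type u) [Field F] [Algebra k F], IntClosed (algebraMap k F) →
      IsDomain (K ⊗[k] F) ∧ IsIntegrallyClosed (K ⊗[k] F) := by
  -- The field structure is chosen to extend the given ring structure, so that for a tensor product
  -- such as `k' ⊗ k₁` the instances agree.
  obtain ⟨f, rfl⟩ : ∃ f : Field K, f.toCommRing = inst := ⟨hf.toField, rfl⟩
  exact ⟨.of_isSeparableExtension hK p, fun F _ _ hF ↦ isIntegrallyClosed_tensorProduct hK p hF⟩

lemma isPurelyInseparableHom_of_pow_mem {R S : Type u} [iR : CommRing R] [iS : CommRing S]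
    (hR : IsField R) (hS : IsField S) (p : ℕ) [Fact p.Prime] [CharP R p] {i : R →+* S}
    (h : ∀ x : S, x ^ p ∈ i.range) : IsPurelyInseparableHom i := by
  obtain ⟨f, rfl⟩ : ∃ f : Field R, f.toCommRing = iR := ⟨hR.toField, rfl⟩
  obtain ⟨g, rfl⟩ : ∃ f : Field S, f.toCommRing = iS := ⟨hS.toField, rfl⟩
  let := i.toAlgebra
  have : ExpChar R p := .prime Fact.out
  exact (isPurelyInseparable_iff_pow_mem R p).mpr fun x ↦ ⟨1, by rw [pow_one]; exact h x⟩

lemma isAlgebraicElem_iff_of_isField {R S : Type u} [iR : CommRing R] [CommRing S]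
    (hR : IsField R) (i : R →+* S) (x : S) : IsAlgebraicElem i x ↔ i.IsIntegralElem x := by
  obtain ⟨f, rfl⟩ : ∃ f : Field R, f.toCommRing = iR := ⟨hR.toField, rfl⟩
  exact isAlgebraicElem_iff_isIntegralElem i x

lemma isIntegralElem_of_pow_mem {R S : Type*} [CommRing R] [CommRing S] {i : R →+* S} {x : S}
    {n : ℕ} (hn : n ≠ 0) (h : x ^ n ∈ i.range) : i.IsIntegralElem x := by
  obtain ⟨c, hc⟩ := h
  exact ⟨Polynomial.X ^ n - Polynomial.C c, Polynomial.monic_X_pow_sub_C c hn, by simp [hc]⟩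

lemma degree_eq_rank_of_ringEquiv {R S A B : Type u} [CommRing R] [CommRing S] [CommRing A]
    [CommRing B] [Algebra R S] [Algebra R A] [Nontrivial R] [Nontrivial S] [Module.Free R A]
    (i : S →+* B) (e : S ⊗[R] A ≃+* B) (h : ∀ s, e (s ⊗ₜ 1) = i s) :
    degree i = Module.rank R A := by
  let := i.toAlgebra
  let e' : S ⊗[R] A ≃ₐ[S] B := AlgEquiv.ofRingEquiv (f := e) h
  change Module.rank S B = _
  rw [← e'.toLinearEquiv.rank_eq, Module.rank_baseChange, Cardinal.lift_id]

section Degree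

variable {k : Type u} [Field k] (l k' K : Type u) [Field l] [Field k'] [Field K] [Algebra k l]
  [Algebra k k'] [Algebra l k'] [IsScalarTower k l k'] [Algebra k K]

lemma degree_inclRight : degree (inclRight (k := k) K l) = Module.rank k l :=
  degree_eq_rank_of_ringEquiv _ (Algebra.TensorProduct.comm k K l).toRingEquiv fun _ ↦ rfl

lemma degree_tensorMap : degree (tensorMap (k := k) K l k') = Module.rank l k' := by
  refine degree_eq_rank_of_ringEquiv _
    ((Algebra.TensorProduct.comm l (l ⊗[k] K) k').toRingEquiv.trans
      (Algebra.TensorProduct.cancelBaseChange k l l k' K).toRingEquiv) fun s ↦ ?_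
  induction s with
  | zero => simp
  | add a b ha hb => simp only [TensorProduct.add_tmul, map_add, ha, hb]
  | tmul a b => simp [Algebra.algebraMap_eq_smul_one]

end Degree

/-! ### Elemental extensions -/

lemma IsAlgClosedInFunctionField.intClosed {k : Type u} [Field k] {X : Scheme.{u}} [IsIntegral X]
    {α : X ⟶ Spec (CommRingCat.of k)} (h : IsAlgClosedInFunctionField α) :
    IntClosed (toFunctionField α) := fun x hx ↦
  h.mem_range x ((isAlgebraicElem_iff_isIntegralElem _ _).mpr hx)

section Elemental

variable {p : ℕ} [Fact p.Prime] {k l k' : Type u} [Field k] [Field l] [Field k'] [CharP k p]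
  [Algebra k l] [Algebra l k'] [Algebra k k'] [IsScalarTower k l k'] {X X' : Scheme.{u}}
  {α : X ⟶ Spec (CommRingCat.of k)} {α' : X' ⟶ Spec (CommRingCat.of k')} {φ : X' ⟶ X}

/-- Since `K(X') = K(X ×ₖ l)` and `l ^ p ⊆ k`, the element `x ^ p` comes from `K(X)`. It is
algebraic over `k`, because `k' / l` and `l / k` are, and `k` is algebraically closed in `K(X)`. -/
lemma IsElementalExtension.pow_mem_range_algebraMap [IsIntegral X]
    (hφ : IsElementalExtension p (algebraMap k l) (algebraMap l k') α α' φ)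
    (hα : IntClosed (toFunctionField α)) (x : k') : x ^ p ∈ (algebraMap k k').range := by
  obtain ⟨ν, hν, hcomp⟩ : ∃ ν : X' ⟶ pullback α (specMap (algebraMap k l)),
      IsNormalization ν ∧ ν ≫ pullback.fst _ _ = φ :=
    ⟨_, hφ.isNormalization, pullback.lift_fst _ _ _⟩
  have := hν.isIntegral_source
  have := hν.isIntegral_target
  have := hν.surjective
  have hfst : Surjective (pullback.fst α (specMap (algebraMap k l))) :=
    surjective_fst (IsPullback.of_hasPullback _ _)
  have hφs : Surjective φ := hcomp ▸ inferInstance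
  have hν₀ := map_genericPoint_of_surjective ν
  have hf₀ := map_genericPoint_of_surjective (pullback.fst α (specMap (algebraMap k l)))
  have hφ₀ := map_genericPoint_of_surjective φ
  let : Algebra k X.functionField := (toFunctionField α).toAlgebra
  obtain ⟨z, hz⟩ := ((isIso_stalkMap_iff_bijective ν hν₀).mp hν.isIso_stalkMap).2
    (toFunctionField α' x)
  obtain ⟨w, hw⟩ := pow_mem_range_functionFieldMap rfl (IsPullback.of_hasPullback α
    (specMap (algebraMap k l))) p hφ.pow_mem_range hf₀ z
  have hwx : functionFieldMap φ hφ₀ w = toFunctionField α' (x ^ p) := by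
    rw [functionFieldMap_comp ν _ φ hcomp hν₀ hf₀ hφ₀, hw, map_pow, hz, map_pow]
  have hst (r : k) : functionFieldMap φ hφ₀ (toFunctionField α r) =
      toFunctionField α' (algebraMap k k' r) := by
    refine functionFieldMap_toFunctionField φ hφ₀ α α' (algebraMap k k') ?_ r
    rw [hφ.comm, IsScalarTower.algebraMap_eq k l k']
  have hxl : IsIntegral l x := by
    obtain ⟨P, hP, hPx⟩ := (isAlgebraicElem_iff_isIntegralElem _ _).mp
      ((hφ.isAlgebraicElem_iff (toFunctionField α' x)).mpr ⟨x, rfl⟩)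
    refine ⟨P, hP, (toFunctionField α').injective ?_⟩
    rw [Polynomial.hom_eval₂, hPx, map_zero]
  have : Algebra.IsIntegral k l :=
    ⟨fun y ↦ isIntegralElem_of_pow_mem (Fact.out : p.Prime).ne_zero (hφ.pow_mem_range y)⟩
  obtain ⟨P, hP, hPx⟩ := (isIntegral_trans (R := k) x hxl).pow p
  obtain ⟨c, hc⟩ := hα w ⟨P, hP, (functionFieldMap φ hφ₀).injective (by
    have : (functionFieldMap φ hφ₀).comp (toFunctionField α) =
      (toFunctionField α').comp (algebraMap k k') := RingHom.ext hst
    rw [Polynomial.hom_eval₂, this, hwx, ← Polynomial.hom_eval₂, hPx, map_zero, map_zero])⟩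
  exact ⟨c, (toFunctionField α').injective (by rw [← hst, hc, hwx])⟩

lemma IsElementalExtension.intClosed [IsIntegral X] [IsIntegral X']
    (hφ : IsElementalExtension p (algebraMap k l) (algebraMap l k') α α' φ)
    (hα : IntClosed (toFunctionField α)) : IntClosed (toFunctionField α') := by
  intro x hx
  rw [← hφ.isAlgebraicElem_iff, isAlgebraicElem_iff_isIntegralElem]
  let : Algebra k' X'.functionField := (toFunctionField α').toAlgebra
  let : Algebra l X'.functionField := ((toFunctionField α').comp (algebraMap l k')).toAlgebra
  have : IsScalarTower l k' X'.functionField := .of_algebraMap_eq fun _ ↦ rfl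
  have : Algebra.IsIntegral l k' := ⟨fun y ↦ by
    obtain ⟨c, hc⟩ := hφ.pow_mem_range_algebraMap hα y
    refine isIntegralElem_of_pow_mem (Fact.out : p.Prime).ne_zero ⟨algebraMap k l c, ?_⟩
    rw [← hc, IsScalarTower.algebraMap_apply k l k']⟩
  exact isIntegral_trans (R := l) (A := k') x hx

end Elemental

/-! ### Cartesian squares -/

section Squares

variable {k l k' : Type u} (K : Type u) [Field k] [Field l] [Field k'] [Field K]
  [Algebra k l] [Algebra l k'] [Algebra k k'] [IsScalarTower k l k'] [Algebra k K]
  {X X' : Scheme.{u}} (α : X ⟶ Spec (CommRingCat.of k)) (α' : X' ⟶ Spec (CommRingCat.of k'))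
  (φ : X' ⟶ X)

lemma isPullback_specMap_tensorProduct (A : Type u) [CommRing A] [Algebra k A] :
    IsPullback (specMap (algebraMap A (A ⊗[k] K))) (specMap (inclRight (k := k) K A))
      (specMap (algebraMap k A)) (specMap (algebraMap k K)) :=
  isPullback_SpecMap_of_isPushout _ _ _ _ (CommRingCat.isPushout_tensorProduct k A K)

variable {α α' φ}

lemma baseChangeTop_comp_inclRight (β : X' ⟶ Spec (CommRingCat.of k))
    (h : β = α' ≫ specMap (algebraMap k k')) :
    baseChangeTop K β α' h ≫ specMap (inclRight (k := k) K k') = baseChangeStr K β := by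
  have : (pullbackSpecIso k k' K).hom ≫ specMap (inclRight (k := k) K k') = pullback.snd _ _ :=
    pullbackSpecIso_hom_snd k k' K
  rw [baseChangeTop, Category.assoc, this]
  exact (pullback.lift_snd _ _ _).trans (Category.comp_id _)

lemma baseChangeTop_comp_algebraMap (β : X' ⟶ Spec (CommRingCat.of k))
    (h : β = α' ≫ specMap (algebraMap k k')) :
    baseChangeTop K β α' h ≫ specMap (algebraMap k' (k' ⊗[k] K)) =
      pullback.fst β (specMap (algebraMap k K)) ≫ α' := by
  have := pullbackSpecIso_hom_fst' k k' K
  rw [baseChangeTop, Category.assoc, this]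
  exact pullback.lift_fst _ _ _

/-- Exhibits `X' ×ₖ k₁` as a base change over `k'`, where the algebraic closedness of `k'` in
`K(X')` can be used. -/
lemma isPullback_baseChangeTop (β : X' ⟶ Spec (CommRingCat.of k))
    (h : β = α' ≫ specMap (algebraMap k k')) :
    IsPullback (pullback.fst β (specMap (algebraMap k K))) (baseChangeTop K β α' h) α'
      (specMap (algebraMap k' (k' ⊗[k] K))) := by
  refine .of_bot ?_ (baseChangeTop_comp_algebraMap K β h).symm
    (isPullback_specMap_tensorProduct K k')
  rw [baseChangeTop_comp_inclRight, ← h]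
  exact IsPullback.of_hasPullback _ _

/-- The scheme to be normalised after base change is `(X ×ₖ l) ×ₖ k₁`; the square is obtained by
pasting. -/
lemma isPullback_baseChange_tensorProduct (α : X ⟶ Spec (CommRingCat.of k)) :
    ∃ g : pullback (baseChangeStr K α) (specMap (inclRight (k := k) K l)) ⟶
        pullback α (specMap (algebraMap k l)),
      g ≫ pullback.fst _ _ = pullback.fst _ _ ≫ pullback.fst _ _ ∧
      g ≫ pullback.snd _ _ = pullback.snd _ _ ≫ specMap (algebraMap l (l ⊗[k] K)) ∧
      IsPullback g (pullback.fst (baseChangeStr K α) (specMap (inclRight (k := k) K l)) ≫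
        baseChangeStr K α) (pullback.fst _ _ ≫ α) (specMap (algebraMap k K)) := by
  have hs := (IsPullback.of_hasPullback (baseChangeStr K α)
    (specMap (inclRight (k := k) K l))).flip.paste_horiz (isPullback_specMap_tensorProduct K l)
  rw [← pullback.condition (f := α) (g := specMap (algebraMap k K))] at hs
  have ht := (IsPullback.of_hasPullback α (specMap (algebraMap k l))).flip
  have hw := hs.w.trans (Category.assoc _ _ _).symm
  have hg := ht.lift_snd _ _ hw
  refine ⟨ht.lift _ _ hw, hg, ht.lift_fst _ _ _, ?_⟩
  refine .paste_vert (.of_right ?_ hg ht) (IsPullback.of_hasPullback α (specMap (algebraMap k K)))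
  rwa [ht.lift_fst]

end Squares


/-! ### Base change of varieties and of elemental extensions -/

lemma tensorMap_comp_inclRight {k : Type u} [Field k] (l k' K : Type u) [Field l] [Field k']
    [Field K] [Algebra k l] [Algebra k k'] [Algebra l k'] [IsScalarTower k l k'] [Algebra k K] :
    (tensorMap (k := k) K l k').comp (inclRight (k := k) K l) = inclRight (k := k) K k' := by
  ext x
  simp

lemma tensorMap_comp_algebraMap {k : Type u} [Field k] (l k' K : Type u) [Field l] [Field k']
    [Field K] [Algebra k l] [Algebra k k'] [Algebra l k'] [IsScalarTower k l k'] [Algebra k K] :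
    (tensorMap (k := k) K l k').comp (algebraMap l (l ⊗[k] K)) =
      (algebraMap k' (k' ⊗[k] K)).comp (algebraMap l k') := by
  ext x
  simp

theorem isVariety_baseChangeStr (p : ℕ) [Fact p.Prime] {k k₁ : Type u} [Field k] [Field k₁]
    [CharP k p] [Algebra k k₁] {X : Scheme.{u}} {α : X ⟶ Spec (CommRingCat.of k)}
    (hX : IsVariety α) (hk : IsAlgClosedInFunctionField α)
    (hk₁ : IsSeparableExtension k k₁) :
    IsVariety (baseChangeStr k₁ α) ∧ IsAlgClosedInFunctionField (baseChangeStr k₁ α) ∧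
      (IsNormal X → IsNormal (baseChange k₁ α)) := by
  have := hX.isIntegral
  have := hX.isSeparated
  have := hX.locallyOfFiniteType
  have := hX.quasiCompact
  let : Algebra k X.functionField := (toFunctionField α).toAlgebra
  have sq := IsPullback.of_hasPullback α (specMap (algebraMap k k₁))
  obtain ⟨_, _⟩ := isIntegrallyClosed_tensorProduct hk₁ p (F := X.functionField) hk.intClosed
  have hpres := PreservesIntClosed.of_isSeparableExtension hk₁ p
  have hint : IsIntegral (baseChange k₁ α) := isIntegral_of_isPullback rfl sq
  refine ⟨⟨hint, inferInstance, inferInstance, inferInstance⟩, ⟨fun x hx ↦ ?_⟩,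
    isNormal_of_isPullback rfl sq hpres⟩
  exact intClosed_toFunctionField rfl sq hpres hk.intClosed x
    ((isAlgebraicElem_iff_isIntegralElem _ _).mp hx)

section

variable {p : ℕ} [Fact p.Prime] {k l k' : Type u} (k₁ : Type u) [Field k] [Field l] [Field k']
  [Field k₁] [CharP k p] [Algebra k l] [Algebra l k'] [Algebra k k'] [IsScalarTower k l k']
  [Algebra k k₁] {X X' : Scheme.{u}} {α : X ⟶ Spec (CommRingCat.of k)}
  {α' : X' ⟶ Spec (CommRingCat.of k')}
  {φ : X' ⟶ X}

theorem isPurelyInseparable_baseChange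
    (hl : ∀ x : l, x ^ p ∈ (algebraMap k l).range) (hk' : ∀ x : k', x ^ p ∈ (algebraMap k k').range)
    (hk₁ : IsSeparableExtension k k₁) :
    IsField (l ⊗[k] k₁) ∧ IsField (k' ⊗[k] k₁) ∧
      IsPurelyInseparableHom (inclRight (k := k) k₁ l) ∧
      IsPurelyInseparableHom (tensorMap (k := k) k₁ l k') ∧
      IsPurelyInseparableHom (inclRight (k := k) k₁ k') ∧
      ∀ x : k' ⊗[k] k₁, x ^ p ∈ (inclRight (k := k) k₁ k').range := by
  have hl₁ := isField_tensorProduct_of_pow_mem p hk₁ hl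
  have hk₁' := isField_tensorProduct_of_pow_mem p hk₁ hk'
  have hpl := pow_mem_range_inclRight (K := k₁) p hl
  have hpk' := pow_mem_range_inclRight (K := k₁) p hk'
  have : CharP k₁ p := charP_of_injective_algebraMap (algebraMap k k₁).injective p
  have : CharP (l ⊗[k] k₁) p :=
    charP_of_injective_algebraMap (algebraMap k (l ⊗[k] k₁)).injective p
  refine ⟨hl₁, hk₁', isPurelyInseparableHom_of_pow_mem (Field.toIsField k₁) hl₁ p hpl,
    isPurelyInseparableHom_of_pow_mem hl₁ hk₁' p fun x ↦ ?_,
    isPurelyInseparableHom_of_pow_mem (Field.toIsField k₁) hk₁' p hpk', hpk'⟩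
  obtain ⟨c, hc⟩ := hpk' x
  exact ⟨inclRight (k := k) k₁ l c, by rw [← hc, ← tensorMap_comp_inclRight l k' k₁]; rfl⟩

theorem IsElementalExtension.baseChange [IsIntegral X]
    (hα : IntClosed (toFunctionField α))
    (hφ : IsElementalExtension p (algebraMap k l) (algebraMap l k') α α' φ)
    (hk₁ : IsSeparableExtension k k₁) (h : φ ≫ α = α' ≫ specMap (algebraMap k k')) :
    IsElementalExtension p (inclRight (k := k) k₁ l) (tensorMap (k := k) k₁ l k')
      (baseChangeStr k₁ α) (baseChangeTop k₁ (φ ≫ α) α' h) (baseChangeMap k₁ α φ) := by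
  have hk' := hφ.pow_mem_range_algebraMap hα
  obtain ⟨hl₁, hk₁', hins, -, -, hpk'⟩ := isPurelyInseparable_baseChange k₁ hφ.pow_mem_range hk' hk₁
  have := hφ.isNormalization.isIntegral_source
  have hα' := hφ.intClosed hα
  let : Algebra k' X'.functionField := (toFunctionField α').toAlgebra
  have : CharP k' p := charP_of_injective_algebraMap (algebraMap k k').injective p
  have : Nontrivial (k' ⊗[k] k₁) := hk₁'.nontrivial
  obtain ⟨hpres, hdom⟩ := isIntegrallyClosed_tensorProduct_of_isField hk₁' p
    hk₁.baseChange_isReduced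
  obtain ⟨_, _⟩ := hdom X'.functionField hα'
  have sq := isPullback_baseChangeTop k₁ (φ ≫ α) h
  have hint := isIntegral_of_isPullback rfl sq
  have hnorm := isNormal_of_isPullback rfl sq hpres hφ.isNormalization.isNormal
  have hfst : baseChangeMap k₁ α φ ≫ pullback.fst _ _ = pullback.fst _ _ ≫ φ :=
    pullback.lift_fst _ _ _
  have hsnd : baseChangeMap k₁ α φ ≫ baseChangeStr k₁ α = baseChangeStr k₁ (φ ≫ α) :=
    (pullback.lift_snd _ _ _).trans (Category.comp_id _)
  have hcomm : baseChangeMap k₁ α φ ≫ baseChangeStr k₁ α = baseChangeTop k₁ (φ ≫ α) α' h ≫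
      specMap ((tensorMap (k := k) k₁ l k').comp (inclRight (k := k) k₁ l)) := by
    rw [tensorMap_comp_inclRight, baseChangeTop_comp_inclRight, hsnd]
  -- Stated for any morphism with the right components, so that the proof does not depend on how the
  -- lift is built.
  have key (ν₁ : ElementalExt.baseChange k₁ (φ ≫ α) ⟶
      pullback (baseChangeStr k₁ α) (specMap (inclRight (k := k) k₁ l)))
      (h₁ : ν₁ ≫ pullback.fst _ _ = baseChangeMap k₁ α φ)
      (h₂ : ν₁ ≫ pullback.snd _ _ = baseChangeTop k₁ (φ ≫ α) α' h ≫
        specMap (tensorMap (k := k) k₁ l k')) : IsNormalization ν₁ := by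
    obtain ⟨g, hg₁, hg₂, sqZ⟩ := isPullback_baseChange_tensorProduct (l := l) k₁ α
    obtain ⟨ν, hν, hν₁, hν₂⟩ : ∃ ν : X' ⟶ pullback α (specMap (algebraMap k l)),
        IsNormalization ν ∧ ν ≫ pullback.fst _ _ = φ ∧
          ν ≫ pullback.snd _ _ = α' ≫ specMap (algebraMap l k') :=
      ⟨_, hφ.isNormalization, pullback.lift_fst _ _ _, pullback.lift_snd _ _ _⟩
    have sqX := IsPullback.of_hasPullback (φ ≫ α) (specMap (algebraMap k k₁))
    refine .of_isPullback hν sqZ (y := baseChangeStr k₁ (φ ≫ α)) (f := pullback.fst _ _) ?_ ?_ ?_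
      hnorm
    · rwa [← Category.assoc, hν₁]
    · apply pullback.hom_ext
      · rw [Category.assoc, Category.assoc, hg₁, reassoc_of% h₁, hν₁, hfst]
      · rw [Category.assoc, Category.assoc, hg₂, reassoc_of% h₂, hν₂,
          ← reassoc_of% baseChangeTop_comp_algebraMap k₁ (φ ≫ α) h]
        congr 1
        simp only [specMap, ← Spec.map_comp, ← CommRingCat.ofHom_comp, tensorMap_comp_algebraMap]
    · rw [reassoc_of% h₁, hsnd]
  have hν₁ := key _ (pullback.lift_fst (baseChangeMap k₁ α φ) (baseChangeTop k₁ (φ ≫ α) α' h ≫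
      specMap (tensorMap (k := k) k₁ l k')) (by rw [hcomm]; simp [specMap]))
    (pullback.lift_snd _ _ _)
  refine ⟨hl₁, hk₁', hins, pow_mem_range_inclRight p hφ.pow_mem_range, hν₁.isIntegral_target, hcomm,
    hν₁, fun x ↦ ?_⟩
  rw [isAlgebraicElem_iff_of_isField hl₁]
  -- Integrality over `l ⊗ k₁` implies integrality over `k' ⊗ k₁`, which is integrally closed in the
  -- function field. Conversely, an element of `k' ⊗ k₁` is a root of `X ^ p - c` with `c` from
  -- `k₁`.
  refine ⟨fun hx ↦ intClosed_toFunctionField rfl sq hpres hα' x ?_, ?_⟩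
  · obtain ⟨P, hP, hPx⟩ := hx
    exact ⟨P.map (tensorMap (k := k) k₁ l k'), hP.map _, by rwa [Polynomial.eval₂_map]⟩
  · rintro ⟨y, rfl⟩
    obtain ⟨c, hc⟩ := hpk' y
    refine isIntegralElem_of_pow_mem (Fact.out : p.Prime).ne_zero
      ⟨inclRight (k := k) k₁ l c, ?_⟩
    rw [← map_pow, ← hc, ← tensorMap_comp_inclRight l k' k₁]
    rfl

end

end ElementalExt
theorem mainTheorem8 (p : ℕ) [Fact p.Prime]
    (k l k' k₁ : Type u) [Field k] [Field l] [Field k'] [Field k₁] [CharP k p]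
    [Algebra k l] [Algebra l k'] [Algebra k k'] [IsScalarTower k l k'] [Algebra k k₁]
    (X X' : Scheme.{u}) (α : X ⟶ Spec (CommRingCat.of k)) (α' : X' ⟶ Spec (CommRingCat.of k'))
    (φ : X' ⟶ X)
    (hX : IsVariety α) (hk : IsAlgClosedInFunctionField α)
    (hφ : IsElementalExtension p (algebraMap k l) (algebraMap l k') α α' φ)
    (hk₁ : IsSeparableExtension k k₁) :
    (IsVariety (baseChangeStr k₁ α) ∧ IsAlgClosedInFunctionField (baseChangeStr k₁ α) ∧
      (IsNormal X → IsNormal (baseChange k₁ α))) ∧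
    (IsField (l ⊗[k] k₁) ∧ IsField (k' ⊗[k] k₁) ∧
      IsPurelyInseparableHom (inclRight (k := k) k₁ l) ∧
      IsPurelyInseparableHom (tensorMap (k := k) k₁ l k') ∧
      IsPurelyInseparableHom (inclRight (k := k) k₁ k') ∧
      ∀ x : k' ⊗[k] k₁, x ^ p ∈ (inclRight (k := k) k₁ k').range) ∧
    (degree (inclRight (k := k) k₁ l) = Module.rank k l ∧
      degree (tensorMap (k := k) k₁ l k') = Module.rank l k' ∧
      degree (inclRight (k := k) k₁ k') = Module.rank k k') ∧
    IsElementalExtension p (inclRight (k := k) k₁ l) (tensorMap (k := k) k₁ l k')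
      (baseChangeStr k₁ α)
      (baseChangeTop k₁ (φ ≫ α) α'
        (hφ.comm.trans (by rw [IsScalarTower.algebraMap_eq k l k'])))
      (baseChangeMap k₁ α φ) := by
  have := hX.isIntegral
  exact ⟨isVariety_baseChangeStr p hX hk hk₁,
    isPurelyInseparable_baseChange k₁ hφ.pow_mem_range
      (hφ.pow_mem_range_algebraMap hk.intClosed) hk₁,
    ⟨degree_inclRight l k₁, degree_tensorMap l k' k₁, degree_inclRight k' k₁⟩,
    hφ.baseChange k₁ hk.intClosed hk₁ _⟩
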